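/- A \emph{convex lattice polygon} is a subset $P\subset\mathbb R^2$ with nonempty interior that is the convex hull of finitely many points of $\mathbb Z^2$. Let $a(P)$ be its area, $b(P)$ the number of lattice points (points of $\mathbb Z^2$) on its boundary, and $i(P)$ the number of lattice points in its interior. \textbf{(1) Classification.} For real numbers $a,b,i$ the following are equivalent: \begin{itemize} \item there is a convex lattice polygon $P$ with $(a(P),b(P),i(P))=(a,b,i)$; \item $b\in\mathbb Z_{\ge 3}$, $i\in\mathbb Z_{\ge 0}$, $a=i+\frac b2-1$, and one of the following holds: $i=0$; or $i=1$ and $b\le 9$; or $i\ge 2$ and $b\le 2i+6$. \end{itemize} \textbf{(2) Level.} For $P\subset\mathbb R^2$ let $P^{(1)}$ be the convex hull of the lattice points in the interior of $P$, and let $P^{(0)}=P$ and $P^{(k+1)}=(P^{(k)})^{(1)}$. For a convex lattice polygon $P$ let $n\ge 0$ be the least integer such that the interior of $P^{(n)}$ contains no lattice point. Let $\Delta$ be the triangle with vertices $(0,0),(1,0),(0,1)$, and call two sets lattice equivalent if an affine automorphism of $\mathbb R^2$ that maps $\mathbb Z^2$ onto itself takes one to the other. The level $\ell(P)$ is $n$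 if $P^{(n)}$ has empty interior (is a segment or a point); otherwise it is $n+\frac13$ if $P^{(n)}$ is lattice equivalent to $\Delta$, $n+\frac23$ if $P^{(n)}$ is lattice equivalent to $2\Delta$, and $n+\frac12$ in all other cases. Every convex lattice polygon $P$, with $b=b(P)$, $i=i(P)$ and $\ell=\ell(P)$, satisfies $$(2\ell-1)\,b\le 2i+9\ell^2-2 .$$ \textbf{(3) Explicit families.} Every triple allowed in (1) is realized by one of the following convex lattice polygons, each of which has the indicated values $b,i$ (integers) and area $i+\frac b2-1$: \begin{itemize} \item $i=0$, $b\ge 3$: $\operatorname{conv}\{(0,0),(b-2,0),(0,1)\}$; \item $i\ge 1$, $b=3$: $\operatorname{conv}\{(0,0),(1,2),(i+1,1)\}$; \item $i\ge 1$, $4\le b\le 2i+6$: $\operatorname{conv}\{(0,0),(b-4,0),(i+1,1),(0,2)\}$; \item $i=1$, $b=9$: $3\Delta=\operatorname{conv}\{(0,0),(3,0),(0,3)\}$. \end{itemize} -/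

import Mathlib

open Set MeasureTheory

noncomputable section

namespace LatticePolygon

/-- The integer lattice `ℤ²` inside the plane `ℝ²`. -/
def lattice : Set (ℝ × ℝ) := {p | ∃ x y : ℤ, p = ((x : ℝ), (y : ℝ))}

/-- A convex lattice polygon: the convex hull of finitely many lattice points, with nonempty
interior (so that it is genuinely two-dimensional). The polygon is the solid one. -/
def IsConvexLatticePolygon (P : Set (ℝ × ℝ)) : Prop :=
  (∃ V : Finset (ℝ × ℝ), (V : Set (ℝ × ℝ)) ⊆ lattice ∧ P = convexHull ℝ (V : Set (ℝ × ℝ))) ∧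
    (interior P).Nonempty

/-- The area `a(P)`. -/
def area (P : Set (ℝ × ℝ)) : ℝ := (volume P).toReal

/-- The number `b(P)` of lattice points on the boundary. -/
def boundaryPoints (P : Set (ℝ × ℝ)) : ℕ := (frontier P ∩ lattice).ncard

/-- The number `i(P)` of lattice points strictly inside. -/
def interiorPoints (P : Set (ℝ × ℝ)) : ℕ := (interior P ∩ lattice).ncard

/-- `P` is a convex lattice polygon with `(a(P), b(P), i(P)) = (a, b, i)`. -/
def Realizes (P : Set (ℝ × ℝ)) (a b i : ℝ) : Prop :=
  IsConvexLatticePolygon P ∧ area P = a ∧ (boundaryPoints P : ℝ) = b ∧ (interiorPoints P : ℝ) = i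

/-- Lattice equivalence: some affine automorphism of the plane that maps `ℤ²` bijectively to
itself takes `P` to `Q`. -/
def LatticeEquivalent (P Q : Set (ℝ × ℝ)) : Prop :=
  ∃ Φ : (ℝ × ℝ) ≃ᵃ[ℝ] (ℝ × ℝ), Φ '' lattice = lattice ∧ Φ '' P = Q

/-- The dilate `k Δ` of the standard triangle `Δ = conv {(0,0), (1,0), (0,1)}`. -/
def triangle (k : ℝ) : Set (ℝ × ℝ) := convexHull ℝ {(0, 0), (k, 0), (0, k)}

/-- `P⁽¹⁾`: the convex hull of the interior lattice points of `P`. -/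
def peel (P : Set (ℝ × ℝ)) : Set (ℝ × ℝ) := convexHull ℝ (interior P ∩ lattice)

/-- The number `n` of steps after which peeling arrives at the nucleus. A set `P⁽ᵏ⁾` is degenerate
(it has empty interior) or an empty nut (it has nonempty interior, but no lattice points there)
exactly if its interior contains no lattice points; `n` is the first `k` for which this happens.
For a convex lattice polygon there is such a `k`, since each step before it removes lattice points,
and `P⁽ⁿ⁾` is nonempty. -/
def peelCount (P : Set (ℝ × ℝ)) : ℕ := sInf {k : ℕ | interior (peel^[k] P) ∩ lattice = ∅}

/-- The nucleus `P⁽ⁿ⁾`. -/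
def nucleus (P : Set (ℝ × ℝ)) : Set (ℝ × ℝ) := peel^[peelCount P] P

open Classical in
/-- The level `ℓ(P)`: with `n` the number of peelings, it is `n` if the nucleus is degenerate,
`n + 1/3` if it is `Δ`, `n + 2/3` if it is `2Δ` (both up to lattice equivalence), and `n + 1/2` if
it is any other polygon without interior lattice points. -/
def level (P : Set (ℝ × ℝ)) : ℝ :=
  if interior (nucleus P) = ∅ then (peelCount P : ℝ)
  else if LatticeEquivalent (nucleus P) (triangle 1) then (peelCount P : ℝ) + 1 / 3
  else if LatticeEquivalent (nucleus P) (triangle 2) then (peelCount P : ℝ) + 2 / 3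
  else (peelCount P : ℝ) + 1 / 2

end LatticePolygon

end

namespace LatticePolygon

/-! ### Roofs: concave functions that are affine between lattice points of their graph -/

/-! Every convex lattice polygon is the region between a concave roof and a convex floor over an
integral interval, and both are chains of segments between lattice points (`exists_roof`,
`Strip.exists_of_extent`). Area and lattice point counts thus become sums over integral columns.
Pick's formula follows because a half turn about the midpoint of a lattice segment preserves the
lattice, so rounding errors cancel along each segment (`Roof.sum_sawtooth_of_int`, `Strip.pick`).

The upper bounds on b compare P with its peel. If no lattice point lies strictly between two roofs,
the upper one carries at most as many lattice points as the lower one: every lattice point of the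
upper roof has lattice height 1 over the primitive segment below it, and two of them over one
segment would force a lattice point inside that segment (`det_eq_one`, `exists_node_between`,
`sum_chi_le`). When the peel occupies all columns of P but the two outer ones, concavity also bounds
those (`roof_ends_le`). This gives b(P) ≤ b(peel) + 8 for a two-dimensional peel, and b ≤ 2i + 6.

To reach that position, choose lattice coordinates in which the horizontal width is minimal. If a
column next to an end has no interior lattice point, P lies in a unimodular cone
(`Strip.subset_cone`), and minimality of the width forces P to be a multiple kΔ
(`LatticeEquivalent.triangle_of_cone`). For kΔ everything is explicit: b = 3k, and for k ≥ 4 the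
peel is (k-3)Δ, so b drops by 9; 3Δ is the sole exception to b ≤ 2i + 6. The level inequality is
then an induction over peeling, using b(P) ≤ b(peel) + 9 and i(P) = b(peel) + i(peel). -/

/-- A concave function on `[l, r]` whose graph is a chain of segments between lattice points. -/
structure Roof (f : ℝ → ℝ) (l r : ℤ) : Prop where
  concave : ConcaveOn ℝ (Icc (l : ℝ) r) f
  node : ∀ k : ℤ, l ≤ k → k < r → ∃ m n : ℤ, l ≤ m ∧ m ≤ k ∧ k < n ∧ n ≤ r ∧
    (∃ a b : ℤ, f m = a ∧ f n = b) ∧ ∃ c s : ℝ, ∀ x ∈ Icc (m : ℝ) n, f x = c + s * x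
  left : ∃ a : ℤ, f l = a
  right : ∃ a : ℤ, f r = a

/-- `K` is the region between a floor `g` and a roof `f` over `[l, r]`. -/
structure Strip (K : Set (ℝ × ℝ)) (l r : ℤ) (f g : ℝ → ℝ) : Prop where
  le : l ≤ r
  roof : Roof f l r
  floor : Roof (fun x => -g x) l r
  g_le : ∀ x ∈ Icc (l : ℝ) r, g x ≤ f x
  mem_iff : ∀ p : ℝ × ℝ, p ∈ K ↔ p.1 ∈ Icc (l : ℝ) r ∧ p.2 ∈ Icc (g p.1) (f p.1)

/-- The slope is the supremum of the chord slopes to the right of `x`; every chord slope to the left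
bounds these from above. -/
theorem exists_supporting_slope {f : ℝ → ℝ} {a b x : ℝ} (hf : ConcaveOn ℝ (Icc a b) f)
    (hx : x ∈ Ioo a b) : ∃ s : ℝ, ∀ t ∈ Icc a b, f t ≤ f x + s * (t - x) := by
  have hb : ∀ t ∈ Ioc x b, ∀ u ∈ Ico a x, (f t - f x) / (t - x) ≤ (f x - f u) / (x - u) :=
    fun t ht u hu => hf.slope_anti_adjacent ⟨hu.1, hu.2.le.trans hx.2.le⟩
      ⟨hx.1.le.trans ht.1.le, ht.2⟩ hu.2 ht.1
  set A := (fun t => (f t - f x) / (t - x)) '' Ioc x b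
  have hne : A.Nonempty := ⟨_, b, ⟨hx.2, le_rfl⟩, rfl⟩
  have hbdd : BddAbove A := by
    refine ⟨(f x - f a) / (x - a), ?_⟩
    rintro _ ⟨t, ht, rfl⟩
    exact hb t ht a ⟨le_rfl, hx.1⟩
  refine ⟨sSup A, fun t ht => ?_⟩
  rcases lt_trichotomy t x with h | rfl | h
  · have h1 : sSup A ≤ (f x - f t) / (x - t) := by
      refine csSup_le hne ?_
      rintro _ ⟨u, hu, rfl⟩
      exact hb u hu t ⟨ht.1, h⟩
    rw [le_div_iff₀ (by linarith)] at h1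
    linarith
  · simp
  · have h1 : (f t - f x) / (t - x) ≤ sSup A := le_csSup hbdd ⟨t, ⟨h, ht.2⟩, rfl⟩
    rw [div_le_iff₀ (by linarith)] at h1
    linarith

theorem concave_chord_le {f : ℝ → ℝ} {S : Set ℝ} {m n x : ℝ} (hf : ConcaveOn ℝ S f)
    (hm : m ∈ S) (hn : n ∈ S) (hmn : m < n) (hx : x ∈ Icc m n) :
    (n - x) * f m + (x - m) * f n ≤ (n - m) * f x := by
  have h0 : n - m ≠ 0 := by linarith
  have hlow := hf.2 hm hn
    (show 0 ≤ (n - x) / (n - m) from div_nonneg (by linarith [hx.2]) (by linarith))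
    (show 0 ≤ (x - m) / (n - m) from div_nonneg (by linarith [hx.1]) (by linarith))
    (by rw [← add_div, div_eq_one_iff_eq h0]; ring)
  have e : ((n - x) / (n - m)) • m + ((x - m) / (n - m)) • n = x := by
    simp only [smul_eq_mul, div_mul_eq_mul_div]
    rw [← add_div, div_eq_iff h0]
    ring
  rw [e] at hlow
  have h1 := mul_le_mul_of_nonneg_left hlow (show 0 ≤ n - m by linarith)
  have e2 : (n - m) * (((n - x) / (n - m)) • f m + ((x - m) / (n - m)) • f n) =
      (n - x) * f m + (x - m) * f n := by
    simp only [smul_eq_mul]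
    field_simp
  linarith

/-- Points of `V` on a supporting line at a point of the hull, on either side of that point. -/
theorem exists_vertices_on_support {V : Finset (ℝ × ℝ)} {x y s : ℝ}
    (hmem : (x, y) ∈ convexHull ℝ (V : Set (ℝ × ℝ)))
    (hs : ∀ v ∈ V, v.2 ≤ y + s * (v.1 - x)) :
    ∃ u ∈ V, ∃ v ∈ V, u.1 ≤ x ∧ x ≤ v.1 ∧ u.2 = y + s * (u.1 - x) ∧ v.2 = y + s * (v.1 - x) := by
  rw [Finset.mem_convexHull'] at hmem
  obtain ⟨w, hw0, hw1, hw⟩ := hmem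
  have e1 : ∑ v ∈ V, w v * v.1 = x := by
    have := congrArg Prod.fst hw
    simpa [Prod.fst_sum] using this
  have e2 : ∑ v ∈ V, w v * v.2 = y := by
    have := congrArg Prod.snd hw
    simpa [Prod.snd_sum] using this
  have hx0 : ∑ v ∈ V, w v * (v.1 - x) = 0 := by
    simp only [mul_sub, Finset.sum_sub_distrib, ← Finset.sum_mul, e1, hw1]; ring
  have hl0 : ∑ v ∈ V, w v * (y + s * (v.1 - x) - v.2) = 0 := by
    have : ∑ v ∈ V, w v * (y + s * (v.1 - x) - v.2)
        = (∑ v ∈ V, w v) * y + s * ∑ v ∈ V, w v * (v.1 - x) - ∑ v ∈ V, w v * v.2 := by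
      rw [Finset.sum_mul, Finset.mul_sum, ← Finset.sum_add_distrib, ← Finset.sum_sub_distrib]
      exact Finset.sum_congr rfl fun v _ => by ring
    rw [this, hw1, hx0, e2]; ring
  -- The slacks are nonnegative with weighted mean zero, so every point of positive weight lies on
  -- the line. Since the weighted mean abscissa is `x`, such points cannot all lie strictly on one
  -- side of it.
  have hon : ∀ v ∈ V, w v * (y + s * (v.1 - x) - v.2) = 0 :=
    (Finset.sum_eq_zero_iff_of_nonneg fun v hv =>
      mul_nonneg (hw0 v hv) (by linarith [hs v hv])).1 hl0
  have hon' : ∀ v ∈ V, 0 < w v → v.2 = y + s * (v.1 - x) := fun v hv h => by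
    rcases mul_eq_zero.1 (hon v hv) with h' | h'
    · exact absurd h' h.ne'
    · linarith
  obtain ⟨z, hz, hzpos⟩ : ∃ v ∈ V, 0 < w v := by
    by_contra! h
    have : ∑ v ∈ V, w v ≤ 0 := Finset.sum_nonpos h
    linarith
  obtain ⟨u, hu, hupos, hux⟩ : ∃ u ∈ V, 0 < w u ∧ u.1 ≤ x := by
    by_contra! h
    have : 0 < ∑ v ∈ V, w v * (v.1 - x) := by
      refine Finset.sum_pos' (fun v hv => ?_) ⟨z, hz, mul_pos hzpos (by linarith [h z hz hzpos])⟩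
      rcases (hw0 v hv).eq_or_lt with h0 | h0
      · simp [← h0]
      · exact mul_nonneg h0.le (by linarith [h v hv h0])
    linarith
  obtain ⟨v, hv, hvpos, hvx⟩ : ∃ u ∈ V, 0 < w u ∧ x ≤ u.1 := by
    by_contra! h
    have : 0 < ∑ v ∈ V, w v * (x - v.1) := by
      refine Finset.sum_pos' (fun v hv => ?_) ⟨z, hz, mul_pos hzpos (by linarith [h z hz hzpos])⟩
      rcases (hw0 v hv).eq_or_lt with h0 | h0
      · simp [← h0]
      · exact mul_nonneg h0.le (by linarith [h v hv h0])
    have e : ∑ v ∈ V, w v * (x - v.1) = -∑ v ∈ V, w v * (v.1 - x) := by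
      rw [← Finset.sum_neg_distrib]; exact Finset.sum_congr rfl fun v _ => by ring
    linarith
  exact ⟨u, hu, v, hv, hux, hvx, hon' u hu hupos, hon' v hv hvpos⟩

/-- The upper boundary of the hull of finitely many lattice points is a roof. -/
theorem exists_roof {V : Finset (ℝ × ℝ)} (hV : (V : Set (ℝ × ℝ)) ⊆ lattice) {l r : ℤ}
    (hlr : ∀ v ∈ V, (l : ℝ) ≤ v.1 ∧ v.1 ≤ r) (hl : ∃ v ∈ V, v.1 = l) (hr : ∃ v ∈ V, v.1 = r) :
    ∃ f : ℝ → ℝ, Roof f l r ∧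
      (∀ p ∈ convexHull ℝ (V : Set (ℝ × ℝ)), p.1 ∈ Icc (l : ℝ) r ∧ p.2 ≤ f p.1) ∧
      ∀ x ∈ Icc (l : ℝ) r, (x, f x) ∈ convexHull ℝ (V : Set (ℝ × ℝ)) := by
  set K := convexHull ℝ (V : Set (ℝ × ℝ)) with hK
  have hKc : Convex ℝ K := convex_convexHull ℝ _
  have hVK : ∀ v ∈ V, v ∈ K := fun v hv => subset_convexHull ℝ _ hv
  have hcomp : IsCompact K := V.finite_toSet.isCompact_convexHull ℝ
  have hKx : ∀ p ∈ K, p.1 ∈ Icc (l : ℝ) r := by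
    have : K ⊆ Prod.fst ⁻¹' Icc (l : ℝ) r :=
      convexHull_min (fun v hv => hlr v hv)
        ((convex_Icc (l : ℝ) r).linear_preimage (LinearMap.fst ℝ ℝ ℝ))
    exact this
  have hne : ∀ x ∈ Icc (l : ℝ) r, {y | (x, y) ∈ K}.Nonempty := by
    intro x hx
    obtain ⟨u, hu, hul⟩ := hl
    obtain ⟨v, hv, hvr⟩ := hr
    have hc : (Prod.fst '' K).OrdConnected :=
      (hKc.linear_image (LinearMap.fst ℝ ℝ ℝ)).ordConnected
    have := hc.out ⟨u, hVK u hu, hul⟩ ⟨v, hVK v hv, hvr⟩ hx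
    obtain ⟨p, hp, rfl⟩ := this
    exact ⟨p.2, hp⟩
  have hfib : ∀ x, IsCompact {y | (x, y) ∈ K} := by
    intro x
    have : {y | (x, y) ∈ K} = Prod.snd '' (K ∩ Prod.fst ⁻¹' {x}) := by
      ext y
      constructor
      · intro h; exact ⟨(x, y), ⟨h, rfl⟩, rfl⟩
      · rintro ⟨⟨a, b⟩, ⟨h, rfl⟩, rfl⟩; exact h
    rw [this]
    exact (hcomp.inter_right (isClosed_singleton.preimage continuous_fst)).image continuous_snd
  set f : ℝ → ℝ := fun x => sSup {y | (x, y) ∈ K} with hf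
  have hle : ∀ p ∈ K, p.2 ≤ f p.1 := fun p hp => le_csSup (hfib p.1).bddAbove hp
  have hfm : ∀ x ∈ Icc (l : ℝ) r, (x, f x) ∈ K := fun x hx => (hfib x).sSup_mem (hne x hx)
  have hconc : ConcaveOn ℝ (Icc (l : ℝ) r) f := by
    refine ⟨convex_Icc _ _, fun x hx y hy a b ha hb hab => ?_⟩
    exact hle _ (hKc (hfm x hx) (hfm y hy) ha hb hab)
  have hchord : ∀ x s : ℝ, x ∈ Icc (l : ℝ) r →
      (∀ t ∈ Icc (l : ℝ) r, f t ≤ f x + s * (t - x)) →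
      ∃ m n : ℤ, l ≤ m ∧ (m : ℝ) ≤ x ∧ x ≤ n ∧ n ≤ r ∧
        (∃ a b : ℤ, f m = a ∧ f n = b) ∧
        f m = f x + s * (m - x) ∧ f n = f x + s * (n - x) := by
    intro x s hx hs
    obtain ⟨u, hu, v, hv, hux, hxv, hu2, hv2⟩ := exists_vertices_on_support (hfm x hx)
      (fun v hv => (hle v (hVK v hv)).trans (hs v.1 (hKx v (hVK v hv))))
    have hmu := hKx u (hVK u hu)
    have hmv := hKx v (hVK v hv)
    have fu : f u.1 = u.2 :=
      le_antisymm ((hs u.1 hmu).trans hu2.ge) (hle u (hVK u hu))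
    have fv : f v.1 = v.2 :=
      le_antisymm ((hs v.1 hmv).trans hv2.ge) (hle v (hVK v hv))
    obtain ⟨m, a, rfl⟩ := hV hu
    obtain ⟨n, b, rfl⟩ := hV hv
    simp only at *
    exact ⟨m, n, by exact_mod_cast hmu.1, hux, hxv, by exact_mod_cast hmv.2, ⟨a, b, fu, fv⟩,
      by rw [fu, hu2], by rw [fv, hv2]⟩
  have hnode : ∀ k : ℤ, l ≤ k → k < r → ∃ m n : ℤ, l ≤ m ∧ m ≤ k ∧ k < n ∧ n ≤ r ∧
      (∃ a b : ℤ, f m = a ∧ f n = b) ∧ ∃ c s : ℝ, ∀ x ∈ Icc (m : ℝ) n, f x = c + s * x := by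
    intro k hlk hkr
    have h1 : (l : ℝ) ≤ k := by exact_mod_cast hlk
    have h2 : (k : ℝ) + 1 ≤ r := by exact_mod_cast hkr
    -- At a half-integral abscissa the two lattice points of contact are forced to lie at `m ≤ k`
    -- and `n ≥ k + 1`.
    have hx : (k : ℝ) + 1 / 2 ∈ Ioo (l : ℝ) r := ⟨by linarith, by linarith⟩
    obtain ⟨s, hs⟩ := exists_supporting_slope hconc hx
    obtain ⟨m, n, hlm, hmx, hxn, hnr, hint, hm, hn⟩ := hchord _ s ⟨hx.1.le, hx.2.le⟩ hs
    set x₀ := (k : ℝ) + 1 / 2 with hx₀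
    have hmk : m ≤ k := by
      have : (m : ℝ) < k + 1 := by linarith
      have : m < k + 1 := by exact_mod_cast this
      omega
    have hkn : k < n := by
      have : (k : ℝ) < n := by linarith
      exact_mod_cast this
    refine ⟨m, n, hlm, hmk, hkn, hnr, hint, f x₀ - s * x₀, s, fun x hxm => ?_⟩
    have hlm' : (l : ℝ) ≤ m := by exact_mod_cast hlm
    have hnr' : (n : ℝ) ≤ r := by exact_mod_cast hnr
    have hmn : (m : ℝ) < n := by exact_mod_cast hmk.trans_lt hkn
    have hup := hs x ⟨hlm'.trans hxm.1, hxm.2.trans hnr'⟩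
    -- The chord from `m` to `n` lies on the supporting line, so `f` is squeezed between the two and
    -- agrees with that line on the whole interval.
    have hlow := concave_chord_le hconc ⟨hlm', hmn.le.trans hnr'⟩ ⟨hlm'.trans hmn.le, hnr'⟩ hmn hxm
    rw [hm, hn] at hlow
    have h3 : ((n : ℝ) - m) * (f x₀ + s * (x - x₀)) ≤ (n - m) * f x := by linarith
    have := le_of_mul_le_mul_left h3 (by linarith)
    linarith
  have hends : (∃ a : ℤ, f l = a) ∧ ∃ a : ℤ, f r = a := by
    have hlr' : l ≤ r := by
      obtain ⟨u, hu, hul⟩ := hl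
      have := (hlr u hu).2
      rw [hul] at this
      exact_mod_cast this
    rcases hlr'.eq_or_lt with rfl | hlt
    · obtain ⟨m, n, hlm, hmx, -, -, ⟨a, b, ha, -⟩, -, -⟩ := hchord l 0 ⟨le_rfl, le_rfl⟩
        (fun t ht => by rw [le_antisymm ht.2 ht.1]; simp)
      have : m = l := le_antisymm (by exact_mod_cast hmx) hlm
      subst this
      exact ⟨⟨a, ha⟩, ⟨a, ha⟩⟩
    · obtain ⟨m, n, h1, h2, -, -, ⟨a, b, ha, -⟩, -⟩ := hnode l le_rfl hlt
      obtain ⟨m', n', -, -, h3, h4, ⟨a', b', -, hb'⟩, -⟩ := hnode (r - 1) (by omega) (by omega)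
      obtain rfl : m = l := le_antisymm h2 h1
      obtain rfl : n' = r := by omega
      exact ⟨⟨a, ha⟩, ⟨b', hb'⟩⟩
  exact ⟨f, ⟨hconc, hnode, hends.1, hends.2⟩, fun p hp => ⟨hKx p hp, hle p hp⟩, hfm⟩

/-- The reflection in the horizontal axis. -/
def flip : (ℝ × ℝ) ≃ₗ[ℝ] (ℝ × ℝ) := (LinearEquiv.refl ℝ ℝ).prodCongr (LinearEquiv.neg ℝ)

@[simp] theorem flip_apply (p : ℝ × ℝ) : flip p = (p.1, -p.2) := rfl

/-- The floor is the roof of the mirror image. The interval is prescribed in advance because the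
comparison with a peel needs its exact columns. -/
theorem Strip.exists_of_extent {V : Finset (ℝ × ℝ)} (hV : (V : Set (ℝ × ℝ)) ⊆ lattice) {l r : ℤ}
    (hlr : ∀ v ∈ V, (l : ℝ) ≤ v.1 ∧ v.1 ≤ r) (hl : ∃ v ∈ V, v.1 = l) (hr : ∃ v ∈ V, v.1 = r) :
    ∃ f g : ℝ → ℝ, Strip (convexHull ℝ (V : Set (ℝ × ℝ))) l r f g := by
  classical
  obtain ⟨f, hf, hfle, hfm⟩ := exists_roof hV hlr hl hr
  have hflip : flip '' convexHull ℝ (V : Set (ℝ × ℝ))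
      = convexHull ℝ ((V.image flip : Finset (ℝ × ℝ)) : Set (ℝ × ℝ)) := by
    rw [Finset.coe_image]
    exact flip.toLinearMap.image_convexHull _
  obtain ⟨g, hg, hgle, hgm⟩ := exists_roof (V := V.image flip) (l := l) (r := r)
    (by
      intro p hp
      simp only [Finset.coe_image, mem_image] at hp
      obtain ⟨v, hv, rfl⟩ := hp
      obtain ⟨x, y, rfl⟩ := hV hv
      exact ⟨x, -y, by simp⟩)
    (by
      intro p hp
      obtain ⟨v, hv, rfl⟩ := Finset.mem_image.1 hp
      exact hlr v hv)
    (by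
      obtain ⟨v, hv, h⟩ := hl
      exact ⟨_, Finset.mem_image_of_mem _ hv, h⟩)
    (by
      obtain ⟨v, hv, h⟩ := hr
      exact ⟨_, Finset.mem_image_of_mem _ hv, h⟩)
  rw [← hflip] at hgle hgm
  have hgm' : ∀ x ∈ Icc (l : ℝ) r, (x, -g x) ∈ convexHull ℝ (V : Set (ℝ × ℝ)) := by
    intro x hx
    obtain ⟨q, hq, h⟩ := hgm x hx
    have : q = (x, -g x) := by
      simp only [flip_apply, Prod.mk.injEq] at h
      exact Prod.ext h.1 (by simp only; linarith [h.2])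
    rwa [← this]
  have hgle' : ∀ p ∈ convexHull ℝ (V : Set (ℝ × ℝ)), -g p.1 ≤ p.2 := by
    intro p hp
    have := (hgle _ (mem_image_of_mem flip hp)).2
    simp only [flip_apply] at this
    linarith
  refine ⟨f, fun x => -g x, ⟨?_, hf, by simpa using hg, fun x hx => hgle' _ (hfm x hx), ?_⟩⟩
  · obtain ⟨u, hu, hul⟩ := hl
    have := (hlr u hu).2
    rw [hul] at this
    exact_mod_cast this
  · intro p
    refine ⟨fun hp => ⟨(hfle p hp).1, hgle' p hp, (hfle p hp).2⟩, ?_⟩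
    rintro ⟨hx, h1, h2⟩
    have hseg : p ∈ segment ℝ (p.1, -g p.1) (p.1, f p.1) := by
      rw [← Prod.image_mk_segment_right]
      exact ⟨p.2, by rw [segment_eq_Icc (h1.trans h2)]; exact ⟨h1, h2⟩, rfl⟩
    exact (convex_convexHull ℝ _).segment_subset (hgm' _ hx) (hfm _ hx) hseg

theorem Strip.exists_of_hull {V : Finset (ℝ × ℝ)} (hV : (V : Set (ℝ × ℝ)) ⊆ lattice)
    (hne : V.Nonempty) :
    ∃ (l r : ℤ) (f g : ℝ → ℝ), Strip (convexHull ℝ (V : Set (ℝ × ℝ))) l r f g := by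
  obtain ⟨u, hu, hmin⟩ := V.exists_min_image Prod.fst hne
  obtain ⟨v, hv, hmax⟩ := V.exists_max_image Prod.fst hne
  obtain ⟨l, a, hl⟩ := hV hu
  obtain ⟨r, b, hr⟩ := hV hv
  refine ⟨l, r, Strip.exists_of_extent hV (fun w hw => ?_) ⟨u, hu, by rw [hl]⟩ ⟨v, hv, by rw [hr]⟩⟩
  have h1 := hmin w hw
  have h2 := hmax w hw
  rw [hl] at h1
  rw [hr] at h2
  exact ⟨h1, h2⟩

/-! ### Counting lattice points by columns -/

/-- The `+ 1` in the hypothesis admits empty columns with `b k = a k - 1`, for which the summand is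
still correct. -/
theorem ncard_columns (I : Finset ℤ) (a b : ℤ → ℤ) (h : ∀ k ∈ I, a k ≤ b k + 1) :
    {p : ℝ × ℝ | ∃ k y : ℤ, k ∈ I ∧ a k ≤ y ∧ y ≤ b k ∧ p = ((k : ℝ), (y : ℝ))}.Finite ∧
    (({p : ℝ × ℝ | ∃ k y : ℤ, k ∈ I ∧ a k ≤ y ∧ y ≤ b k ∧ p = ((k : ℝ), (y : ℝ))}.ncard : ℕ) : ℤ)
      = ∑ k ∈ I, (b k - a k + 1) := by
  classical
  have e : {p : ℝ × ℝ | ∃ k y : ℤ, k ∈ I ∧ a k ≤ y ∧ y ≤ b k ∧ p = ((k : ℝ), (y : ℝ))}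
      = (((I.sigma fun k => Finset.Icc (a k) (b k)).image
          fun s => ((s.1 : ℝ), (s.2 : ℝ)) : Finset (ℝ × ℝ)) : Set (ℝ × ℝ)) := by
    ext p
    simp only [mem_ofPred_eq, Finset.coe_image, mem_image, Finset.mem_coe, Finset.mem_sigma,
      Finset.mem_Icc]
    constructor
    · rintro ⟨k, y, hk, h1, h2, rfl⟩
      exact ⟨⟨k, y⟩, ⟨hk, h1, h2⟩, rfl⟩
    · rintro ⟨⟨k, y⟩, ⟨hk, h1, h2⟩, rfl⟩
      exact ⟨k, y, hk, h1, h2, rfl⟩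
  rw [e]
  refine ⟨Finset.finite_toSet _, ?_⟩
  rw [ncard_coe_finset, Finset.card_image_of_injective, Finset.card_sigma]
  · push_cast
    refine Finset.sum_congr rfl fun k hk => ?_
    rw [Int.card_Icc, Int.toNat_of_nonneg (by linarith [h k hk])]
    ring
  · rintro ⟨k, y⟩ ⟨k', y'⟩ hkk
    simp only [Prod.mk.injEq, Int.cast_inj] at hkk
    obtain ⟨rfl, rfl⟩ := hkk
    rfl

/-- `1` on integers and `0` elsewhere. -/
noncomputable def chi (x : ℝ) : ℤ := ⌊x⌋ - ⌈x⌉ + 1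

namespace Strip

variable {K : Set (ℝ × ℝ)} {l r : ℤ} {f g : ℝ → ℝ}

theorem lattice_eq (h : Strip K l r f g) : K ∩ lattice =
    {p : ℝ × ℝ | ∃ k y : ℤ, k ∈ Finset.Icc l r ∧ ⌈g k⌉ ≤ y ∧ y ≤ ⌊f k⌋ ∧
      p = ((k : ℝ), (y : ℝ))} := by
  ext p
  constructor
  · rintro ⟨hp, k, y, rfl⟩
    obtain ⟨⟨h1, h2⟩, h3, h4⟩ := (h.mem_iff _).1 hp
    exact ⟨k, y, Finset.mem_Icc.2 ⟨Int.cast_le.1 h1, Int.cast_le.1 h2⟩,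
      Int.ceil_le.2 h3, Int.le_floor.2 h4, rfl⟩
  · rintro ⟨k, y, hk, h3, h4, rfl⟩
    obtain ⟨h1, h2⟩ := Finset.mem_Icc.1 hk
    exact ⟨(h.mem_iff _).2 ⟨⟨Int.cast_le.2 h1, Int.cast_le.2 h2⟩,
      Int.ceil_le.1 h3, Int.le_floor.1 h4⟩, k, y, rfl⟩

theorem g_le_int (h : Strip K l r f g) {k : ℤ} (hk : k ∈ Finset.Icc l r) : g k ≤ f k := by
  obtain ⟨h1, h2⟩ := Finset.mem_Icc.1 hk
  exact h.g_le k ⟨by exact_mod_cast h1, by exact_mod_cast h2⟩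

theorem finite_lattice (h : Strip K l r f g) : (K ∩ lattice).Finite := by
  rw [h.lattice_eq]
  refine (ncard_columns _ (fun k => ⌈g k⌉) (fun k => ⌊f k⌋) fun k hk => ?_).1
  have := h.g_le_int hk
  rw [Int.ceil_le]
  push_cast
  linarith [Int.lt_floor_add_one (f k)]

theorem lattice_ncard (h : Strip K l r f g) :
    ((K ∩ lattice).ncard : ℤ) = ∑ k ∈ Finset.Icc l r, (⌊f k⌋ - ⌈g k⌉ + 1) := by
  rw [h.lattice_eq]
  refine (ncard_columns _ (fun k => ⌈g k⌉) (fun k => ⌊f k⌋) fun k hk => ?_).2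
  have := h.g_le_int hk
  rw [Int.ceil_le]
  push_cast
  linarith [Int.lt_floor_add_one (f k)]

theorem convex (h : Strip K l r f g) : Convex ℝ K := by
  intro p hp q hq a b ha hb hab
  obtain ⟨hp1, hp2⟩ := (h.mem_iff _).1 hp
  obtain ⟨hq1, hq2⟩ := (h.mem_iff _).1 hq
  have h1 := h.roof.concave.2 hp1 hq1 ha hb hab
  have h2 := h.floor.concave.2 hp1 hq1 ha hb hab
  refine (h.mem_iff _).2 ⟨convex_Icc _ _ hp1 hq1 ha hb hab, ?_, ?_⟩
  · simp only [smul_eq_mul] at h2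
    have e1 := mul_le_mul_of_nonneg_left hp2.1 ha
    have e2 := mul_le_mul_of_nonneg_left hq2.1 hb
    simp only [Prod.fst_add, Prod.snd_add, Prod.smul_fst, Prod.smul_snd, smul_eq_mul]
    linarith
  · simp only [smul_eq_mul] at h1
    have e1 := mul_le_mul_of_nonneg_left hp2.2 ha
    have e2 := mul_le_mul_of_nonneg_left hq2.2 hb
    simp only [Prod.fst_add, Prod.snd_add, Prod.smul_fst, Prod.smul_snd, smul_eq_mul]
    linarith

theorem interior_eq (h : Strip K l r f g) :
    interior K = {p | p.1 ∈ Ioo (l : ℝ) r ∧ p.2 ∈ Ioo (g p.1) (f p.1)} := by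
  apply Subset.antisymm
  · intro p hp
    obtain ⟨ε, hε, hb⟩ := Metric.isOpen_iff.1 isOpen_interior p hp
    have key : ∀ q : ℝ × ℝ, |q.1 - p.1| < ε → |q.2 - p.2| < ε → q ∈ K := fun q h1 h2 =>
      interior_subset (hb (by
        rw [Metric.mem_ball, Prod.dist_eq, Real.dist_eq, Real.dist_eq]
        exact max_lt h1 h2))
    have e : |ε / 2| < ε := by rw [abs_of_pos (by linarith)]; linarith
    have e0 : |(0 : ℝ)| < ε := by simpa using hε
    have a1 := (h.mem_iff _).1 (key (p.1 + ε / 2, p.2) (by simpa using e) (by simpa using e0))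
    have a2 := (h.mem_iff _).1 (key (p.1 - ε / 2, p.2) (by simpa using e) (by simpa using e0))
    have a3 := (h.mem_iff _).1 (key (p.1, p.2 + ε / 2) (by simpa using e0) (by simpa using e))
    have a4 := (h.mem_iff _).1 (key (p.1, p.2 - ε / 2) (by simpa using e0) (by simpa using e))
    simp only [mem_Icc] at a1 a2 a3 a4
    exact ⟨⟨by linarith, by linarith⟩, by linarith, by linarith⟩
  · refine interior_maximal ?_ ?_
    · rintro p ⟨h1, h2⟩
      exact (h.mem_iff _).2 ⟨⟨h1.1.le, h1.2.le⟩, h2.1.le, h2.2.le⟩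
    -- Concavity gives continuity on the open interval, so the set cut out by strict inequalities is
    -- open.
    · have hf : ContinuousOn f (Ioo (l : ℝ) r) :=
        (h.roof.concave.subset Ioo_subset_Icc_self (convex_Ioo _ _)).continuousOn isOpen_Ioo
      have hg : ContinuousOn (fun x => -g x) (Ioo (l : ℝ) r) :=
        (h.floor.concave.subset Ioo_subset_Icc_self (convex_Ioo _ _)).continuousOn isOpen_Ioo
      have hU : IsOpen (Prod.fst ⁻¹' Ioo (l : ℝ) r : Set (ℝ × ℝ)) :=
        isOpen_Ioo.preimage continuous_fst
      have c1 : ContinuousOn (fun p : ℝ × ℝ => f p.1 - p.2) (Prod.fst ⁻¹' Ioo (l : ℝ) r) :=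
        (hf.comp continuousOn_fst fun p hp => hp).sub continuousOn_snd
      have c2 : ContinuousOn (fun p : ℝ × ℝ => -g p.1 + p.2) (Prod.fst ⁻¹' Ioo (l : ℝ) r) :=
        (hg.comp continuousOn_fst fun p hp => hp).add continuousOn_snd
      have := (c1.isOpen_inter_preimage hU (isOpen_Ioi (a := (0 : ℝ)))).inter
        (c2.isOpen_inter_preimage hU (isOpen_Ioi (a := (0 : ℝ))))
      convert this using 1
      ext p
      simp only [mem_ofPred_eq, mem_inter_iff, mem_preimage, mem_Ioo, mem_Ioi]
      constructor
      · rintro ⟨h1, h2, h3⟩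
        exact ⟨⟨h1, by linarith⟩, h1, by linarith⟩
      · rintro ⟨⟨h1, h2⟩, -, h3⟩
        exact ⟨h1, by linarith, by linarith⟩

/-- The width `f - g` is concave and nonnegative; positive at one point, it is positive throughout
the open interval, by comparison with the end on the far side. -/
theorem lt_of_interior (h : Strip K l r f g) (hne : (interior K).Nonempty) :
    l < r ∧ ∀ x ∈ Ioo (l : ℝ) r, g x < f x := by
  obtain ⟨⟨x₀, y₀⟩, hp⟩ := hne
  rw [h.interior_eq] at hp
  obtain ⟨⟨h1, h2⟩, h3, h4⟩ := hp
  simp only at h1 h2 h3 h4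
  have hlr : (l : ℝ) < r := h1.trans h2
  refine ⟨by exact_mod_cast hlr, fun x hx => ?_⟩
  have hw := h.roof.concave.add h.floor.concave
  have hx0 : x₀ ∈ Icc (l : ℝ) r := ⟨h1.le, h2.le⟩
  have key : ∀ e ∈ Icc (l : ℝ) r, ∀ b : ℝ, 0 < b → b ≤ 1 → x = (1 - b) * e + b * x₀ →
      g x < f x := by
    intro e he b hb hb1 hxe
    have := hw.2 he hx0 (show 0 ≤ 1 - b by linarith) hb.le (by ring)
    simp only [smul_eq_mul, Pi.add_apply, ← hxe] at this
    have e1 : 0 ≤ (1 - b) * (f e + -g e) := mul_nonneg (by linarith) (by linarith [h.g_le e he])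
    have e2 : 0 < b * (f x₀ + -g x₀) := mul_pos hb (by linarith)
    linarith
  rcases le_total x x₀ with hxx | hxx
  · refine key l ⟨le_rfl, hlr.le⟩ ((x - l) / (x₀ - l)) (div_pos (by linarith [hx.1]) (by linarith))
      ((div_le_one (by linarith)).2 (by linarith)) ?_
    have : x₀ - l ≠ 0 := by linarith
    field_simp
    ring
  · refine key r ⟨hlr.le, le_rfl⟩ ((r - x) / (r - x₀)) (div_pos (by linarith [hx.2]) (by linarith))
      ((div_le_one (by linarith)).2 (by linarith)) ?_
    have : (r : ℝ) - x₀ ≠ 0 := by linarith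
    field_simp
    ring

theorem interior_lattice_eq (h : Strip K l r f g) : interior K ∩ lattice =
    {p : ℝ × ℝ | ∃ k y : ℤ, k ∈ Finset.Ioo l r ∧ ⌊g k⌋ + 1 ≤ y ∧ y ≤ ⌈f k⌉ - 1 ∧
      p = ((k : ℝ), (y : ℝ))} := by
  rw [h.interior_eq]
  ext p
  constructor
  · rintro ⟨⟨⟨h1, h2⟩, h3, h4⟩, k, y, rfl⟩
    refine ⟨k, y, Finset.mem_Ioo.2 ⟨Int.cast_lt.1 h1, Int.cast_lt.1 h2⟩,
      Int.floor_lt.2 h3, Int.le_sub_one_of_lt (Int.lt_ceil.2 h4), rfl⟩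
  · rintro ⟨k, y, hk, h3, h4, rfl⟩
    obtain ⟨h1, h2⟩ := Finset.mem_Ioo.1 hk
    exact ⟨⟨⟨Int.cast_lt.2 h1, Int.cast_lt.2 h2⟩,
      Int.floor_lt.1 h3, Int.lt_ceil.1 (Int.lt_of_le_sub_one h4)⟩, k, y, rfl⟩

theorem interiorPoints_eq (h : Strip K l r f g) (hne : (interior K).Nonempty) :
    (interiorPoints K : ℤ) = ∑ k ∈ Finset.Ioo l r, (⌈f k⌉ - ⌊g k⌋ - 1) := by
  have hlt := (h.lt_of_interior hne).2
  rw [interiorPoints, h.interior_lattice_eq,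
    (ncard_columns _ (fun k => ⌊g k⌋ + 1) (fun k => ⌈f k⌉ - 1) fun k hk => ?_).2]
  · exact Finset.sum_congr rfl fun k _ => by ring
  · obtain ⟨h1, h2⟩ := Finset.mem_Ioo.1 hk
    have := hlt k ⟨by exact_mod_cast h1, by exact_mod_cast h2⟩
    have : ⌊g k⌋ < ⌈f k⌉ := Int.lt_ceil.2 ((Int.floor_le _).trans_lt this)
    omega

theorem boundaryPoints_add (h : Strip K l r f g) (hc : IsClosed K) :
    boundaryPoints K + interiorPoints K = (K ∩ lattice).ncard := by
  have hfin := h.finite_lattice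
  have e : K ∩ lattice = (frontier K ∩ lattice) ∪ (interior K ∩ lattice) := by
    rw [← union_inter_distrib_right, hc.frontier_eq, sdiff_union_of_subset interior_subset]
  rw [e, ncard_union_eq
    ((disjoint_interior_frontier.symm).mono inter_subset_left inter_subset_left)
    (hfin.subset (inter_subset_inter_left _ hc.frontier_subset))
    (hfin.subset (inter_subset_inter_left _ interior_subset))]
  rfl

theorem sum_Icc_eq (hlr : l < r) (F : ℤ → ℤ) :
    ∑ k ∈ Finset.Icc l r, F k = ∑ k ∈ Finset.Ioo l r, F k + F l + F r := by
  have e : Finset.Icc l r = insert l (insert r (Finset.Ioo l r)) := by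
    ext k
    simp only [Finset.mem_Icc, Finset.mem_insert, Finset.mem_Ioo]
    omega
  rw [e, Finset.sum_insert, Finset.sum_insert]
  · ring
  · simp
  · simp [hlr.ne]

/-- All lattice points minus the interior ones: an inner column leaves `chi (f k) + chi (g k)`, and
the two outer columns belong wholly to the boundary. -/
theorem boundaryPoints_eq (h : Strip K l r f g) (hc : IsClosed K) (hne : (interior K).Nonempty) :
    (boundaryPoints K : ℤ) = ∑ k ∈ Finset.Ioo l r, (chi (f k) + chi (g k)) +
      (⌊f l⌋ - ⌈g l⌉ + 1) + (⌊f r⌋ - ⌈g r⌉ + 1) := by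
  have h1 := h.boundaryPoints_add hc
  have h2 := h.lattice_ncard
  have h3 := h.interiorPoints_eq hne
  rw [sum_Icc_eq (h.lt_of_interior hne).1] at h2
  have h4 : ∑ k ∈ Finset.Ioo l r, (chi (f k) + chi (g k)) =
      ∑ k ∈ Finset.Ioo l r, (⌊f k⌋ - ⌈g k⌉ + 1) -
      ∑ k ∈ Finset.Ioo l r, (⌈f k⌉ - ⌊g k⌋ - 1) := by
    rw [← Finset.sum_sub_distrib]
    exact Finset.sum_congr rfl fun k _ => by unfold chi; ring
  omega

end Strip

/-! ### Comparison of two roofs with no lattice point in between -/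

set_option maxHeartbeats 800000 in
/-- Let `q₁ = (m, a)`, `q₂ = (n, b)` be consecutive lattice points on the graph of `φ`, and `p` a
lattice point on the graph of `f` above. Then the triangle `q₁ q₂ p` has normalized area `1`. -/
theorem det_eq_one {f φ : ℝ → ℝ} {l r l' r' m n a b k y : ℤ} {c s : ℝ}
    (hf : ConcaveOn ℝ (Icc (l : ℝ) r) f) (hll : l ≤ l') (hrr : r' ≤ r)
    (hlt : ∀ x ∈ Icc (l' : ℝ) r', φ x < f x)
    (hno : ∀ k y : ℤ, l' ≤ k → k ≤ r' → φ k < y → (y : ℝ) < f k → False)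
    (hlm : l' ≤ m) (hmk : m ≤ k) (hkn : k < n) (hnr : n ≤ r')
    (hm : φ m = a) (hn : φ n = b) (hφ : ∀ x ∈ Icc (m : ℝ) n, φ x = c + s * x)
    (hcons : ∀ j : ℤ, m < j → j < n → ∀ z : ℤ, φ j ≠ z) (hy : f k = y) :
    (n - m) * (y - a) - (b - a) * (k - m) = 1 := by
  set N := n - m with hN
  set E := b - a with hE
  set X := k - m with hX
  set Y := y - a with hY
  have hNpos : 0 < N := by omega
  have hmnR : (m : ℝ) < n := by exact_mod_cast hmk.trans_lt hkn
  have hlmR : (l' : ℝ) ≤ m := by exact_mod_cast hlm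
  have hnrR : (n : ℝ) ≤ r' := by exact_mod_cast hnr
  have hllR : (l : ℝ) ≤ l' := by exact_mod_cast hll
  have hrrR : (r' : ℝ) ≤ r := by exact_mod_cast hrr
  have hm' : c + s * m = a := by rw [← hm, hφ m ⟨le_rfl, hmnR.le⟩]
  have hn' : c + s * n = b := by rw [← hn, hφ n ⟨hmnR.le, le_rfl⟩]
  have hsN : s * N = E := by push_cast [hN, hE]; linarith
  have hNR : (0 : ℝ) < N := by exact_mod_cast hNpos
  have hval : ∀ x ∈ Icc (m : ℝ) n, N * φ x = N * a + E * (x - m) := by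
    intro x hx
    rw [hφ x hx, ← hsN, ← hm']; ring
  -- A common divisor `d ≥ 2` would make `q₁ + (N, E) / d` a lattice point of the graph between
  -- consecutive ones.
  have hcop : IsCoprime N E := by
    rw [Int.isCoprime_iff_gcd_eq_one]
    by_contra hg
    obtain ⟨d, hd⟩ : ∃ d : ℕ, d = Int.gcd N E := ⟨_, rfl⟩
    have hd0 : d ≠ 0 := by
      rw [hd]; intro h0
      exact hNpos.ne' (Int.gcd_eq_zero_iff.1 h0).1
    have hd2 : (2 : ℤ) ≤ d := by
      have : d ≠ 1 := by rw [hd]; exact hg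
      omega
    obtain ⟨N', hN'⟩ : (d : ℤ) ∣ N := hd ▸ Int.gcd_dvd_left _ _
    obtain ⟨E', hE'⟩ : (d : ℤ) ∣ E := hd ▸ Int.gcd_dvd_right _ _
    have hN'pos : 0 < N' := by
      by_contra hneg
      have : (d : ℤ) * N' ≤ 0 := mul_nonpos_of_nonneg_of_nonpos (by omega) (by omega)
      omega
    have hN'lt : N' < N := by nlinarith
    refine hcons (m + N') (by omega) (by omega) (a + E') ?_
    have hx : ((m + N' : ℤ) : ℝ) ∈ Icc (m : ℝ) n :=
      ⟨by exact_mod_cast (by omega : m ≤ m + N'), by exact_mod_cast (by omega : m + N' ≤ n)⟩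
    have h1 := hval _ hx
    have h2 : (N : ℝ) = d * N' := by exact_mod_cast hN'
    have h3 : (E : ℝ) = d * E' := by exact_mod_cast hE'
    have h4 : (N : ℝ) * φ ((m + N' : ℤ) : ℝ) = N * ((a + E' : ℤ) : ℝ) := by
      rw [h1]; push_cast; rw [h3, h2]; ring
    exact mul_left_cancel₀ hNR.ne' h4
  -- The vectors `(N, E)` and `(-u, v')` form a basis of `ℤ²`; in it `p - q₁` has coordinates `C`
  -- and `D`, so `D` is the lattice height of `p` over the base.
  obtain ⟨v', u, huv⟩ := hcop
  have huv : v' * N + u * E = 1 := huv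
  set D := N * Y - E * X with hD
  have hkR : (k : ℝ) ∈ Icc (m : ℝ) n := ⟨by exact_mod_cast hmk, by exact_mod_cast hkn.le⟩
  have hDpos : 0 < D := by
    have h1 := hval k hkR
    have h2 := hlt k ⟨hlmR.trans hkR.1, hkR.2.trans hnrR⟩
    rw [hy] at h2
    have h3 := mul_lt_mul_of_pos_left h2 hNR
    have : (0 : ℝ) < D := by
      push_cast [hD, hY, hX]
      nlinarith
    exact_mod_cast this
  by_contra hD1
  have hD2 : 2 ≤ D := by omega
  set C := v' * X + u * Y with hC
  have hXe : X = D * (-u) + C * N := by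
    have : X * (v' * N + u * E) = D * (-u) + C * N := by rw [hD, hC]; ring
    rwa [huv, mul_one] at this
  have hYe : Y = D * v' + C * E := by
    have : Y * (v' * N + u * E) = D * v' + C * E := by rw [hD, hC]; ring
    rwa [huv, mul_one] at this
  -- At height one the triangle's section runs from `C / D` to `(C + D - 1) / D` in units of `(N,
  -- E)`. Among the `D` consecutive integers `C, …, C + D - 1` one is divisible by `D`, so the
  -- section contains a lattice point.
  obtain ⟨t, ht1, ht2⟩ : ∃ t : ℤ, C ≤ D * t ∧ D * t ≤ C + D - 1 := by
    refine ⟨(C + D - 1) / D, ?_, ?_⟩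
    · have := Int.emod_add_mul_ediv (C + D - 1) D
      have := Int.emod_lt_of_pos (C + D - 1) hDpos
      omega
    · have := Int.emod_add_mul_ediv (C + D - 1) D
      have := Int.emod_nonneg (C + D - 1) hDpos.ne'
      omega
  have hDR : (2 : ℝ) ≤ D := by exact_mod_cast hD2
  have hD0 : (D : ℝ) ≠ 0 := by linarith
  have hD10 : (D : ℝ) - 1 ≠ 0 := by linarith
  have ht1R : (C : ℝ) ≤ D * t := by exact_mod_cast ht1
  have ht2R : (D : ℝ) * t ≤ C + D - 1 := by exact_mod_cast ht2
  -- the lattice point `(zx, zy)` at height one in the triangle, and the point of the base behind it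
  obtain ⟨zx, hzx⟩ : ∃ zx : ℤ, zx = m - u + t * N := ⟨_, rfl⟩
  obtain ⟨zy, hzy⟩ : ∃ zy : ℤ, zy = a + v' + t * E := ⟨_, rfl⟩
  set β : ℝ := (D * t - C) / (D - 1) with hβ
  have hβ0 : 0 ≤ β := div_nonneg (by linarith) (by linarith)
  have hβ1 : β ≤ 1 := (div_le_one (by linarith)).2 (by linarith)
  set w : ℝ := m + β * N with hw
  have hnm : (n : ℝ) = m + N := by push_cast [hN]; ring
  have hwI : w ∈ Icc (m : ℝ) n := by
    constructor
    · rw [hw]; nlinarith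
    · rw [hnm, hw]; nlinarith
  have hXR : (X : ℝ) = D * (-u) + C * N := by exact_mod_cast hXe
  have hYR : (Y : ℝ) = D * v' + C * E := by exact_mod_cast hYe
  have hβe : β * (D - 1) = D * t - C := by rw [hβ]; field_simp
  have hkX : (k : ℝ) = m + X := by push_cast [hX]; ring
  have hyY : (y : ℝ) = a + Y := by push_cast [hY]; ring
  have hzxe : (D : ℝ) * zx = k + (D - 1) * w := by
    rw [hw, hkX, hXR, hzx]; push_cast
    linear_combination (-(N : ℝ)) * hβe
  have hφw : φ w = a + E * β := by
    have h1 := hval w hwI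
    have : (N : ℝ) * φ w = N * (a + E * β) := by rw [h1, hw]; ring
    exact mul_left_cancel₀ hNR.ne' this
  have hzye : (D : ℝ) * zy = y + (D - 1) * φ w := by
    rw [hφw, hyY, hYR, hzy]; push_cast
    linear_combination (-(E : ℝ)) * hβe
  have hzI : (zx : ℝ) ∈ Icc (m : ℝ) n := by
    constructor
    · have : (D : ℝ) * m ≤ D * zx := by rw [hzxe]; nlinarith [hkR.1, hwI.1]
      exact le_of_mul_le_mul_left this (by linarith)
    · have : (D : ℝ) * zx ≤ D * n := by rw [hzxe]; nlinarith [hkR.2, hwI.2]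
      exact le_of_mul_le_mul_left this (by linarith)
  have hI : ∀ x ∈ Icc (m : ℝ) n, x ∈ Icc (l : ℝ) r := fun x hx =>
    ⟨hllR.trans (hlmR.trans hx.1), hx.2.trans (hnrR.trans hrrR)⟩
  refine hno zx zy ?_ ?_ ?_ ?_
  · exact_mod_cast hlmR.trans hzI.1
  · exact_mod_cast hzI.2.trans hnrR
  · have h1 := hval zx hzI
    have h2 : N * (zy - a) - E * (zx - m) = 1 := by rw [hzx, hzy]; linear_combination huv
    have h2R : (N : ℝ) * (zy - a) - E * (zx - m) = 1 := by exact_mod_cast h2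
    have : (N : ℝ) * φ zx < N * zy := by rw [h1]; linarith
    exact lt_of_mul_lt_mul_left this hNR.le
  -- Since `D ≥ 2`, the base point has positive weight, and there `φ < f`; concavity puts the new
  -- point strictly below `f`.
  · have h1 := hf.2 (hI k hkR) (hI w hwI) (show 0 ≤ 1 / (D : ℝ) by positivity)
      (show 0 ≤ ((D : ℝ) - 1) / D from div_nonneg (by linarith) (by linarith))
      (by field_simp; ring)
    have e1 : (1 / (D : ℝ)) • (k : ℝ) + (((D : ℝ) - 1) / D) • w = zx := by
      simp only [smul_eq_mul]
      field_simp
      linarith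
    rw [e1, hy] at h1
    have h2 := hlt w ⟨hlmR.trans hwI.1, hwI.2.trans hnrR⟩
    have h3 : (zy : ℝ) = (1 / (D : ℝ)) • (y : ℝ) + (((D : ℝ) - 1) / D) • φ w := by
      simp only [smul_eq_mul]
      field_simp
      linarith
    rw [h3]
    refine lt_of_lt_of_le ?_ h1
    simp only [smul_eq_mul]
    have h4 : 0 < ((D : ℝ) - 1) / D := div_pos (by linarith) (by linarith)
    exact add_lt_add_of_le_of_lt le_rfl (mul_lt_mul_of_pos_left h2 h4)

/-- Between two lattice points on the upper roof there is a lattice point on the lower one. -/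
theorem exists_node_between {f φ : ℝ → ℝ} {l r l' r' k k' : ℤ}
    (hf : ConcaveOn ℝ (Icc (l : ℝ) r) f) (hφ : Roof φ l' r') (hll : l ≤ l') (hrr : r' ≤ r)
    (hlt : ∀ x ∈ Icc (l' : ℝ) r', φ x < f x)
    (hno : ∀ k y : ℤ, l' ≤ k → k ≤ r' → φ k < y → (y : ℝ) < f k → False)
    (hlk : l' ≤ k) (hkk : k < k') (hkr : k' ≤ r')
    (hk : ∃ y : ℤ, f k = y) (hk' : ∃ y : ℤ, f k' = y) :
    ∃ j : ℤ, k < j ∧ j ≤ k' ∧ ∃ z : ℤ, φ j = z := by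
  by_contra! hcon
  obtain ⟨m, n, hlm, hmk, hkn, hnr, ⟨a, b, hm, hn⟩, c, s, hcs⟩ := hφ.node k hlk (by omega)
  have hk'n : k' < n := by
    by_contra hle
    exact hcon n hkn (by omega) b hn
  -- shrink to consecutive lattice points
  obtain ⟨m', ⟨hmm', hm'k, a', ha'⟩, hmax⟩ := Int.exists_greatest_of_bdd
    (P := fun j => m ≤ j ∧ j ≤ k ∧ ∃ z : ℤ, φ j = z) ⟨k, fun j hj => hj.2.1⟩
    ⟨m, le_rfl, hmk, a, hm⟩
  obtain ⟨n', ⟨hn'n, hkn', b', hb'⟩, hmin⟩ := Int.exists_least_of_bdd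
    (P := fun j => j ≤ n ∧ k < j ∧ ∃ z : ℤ, φ j = z) ⟨k, fun j hj => hj.2.1.le⟩
    ⟨n, le_rfl, hkn, b, hn⟩
  have hk'n' : k' < n' := by
    by_contra hle
    exact hcon n' hkn' (by omega) b' hb'
  have hcons : ∀ j : ℤ, m' < j → j < n' → ∀ z : ℤ, φ j ≠ z := by
    intro j h1 h2 z hz
    rcases le_or_gt j k with h | h
    · have := hmax j ⟨by omega, h, z, hz⟩
      omega
    · have := hmin j ⟨by omega, h, z, hz⟩
      omega
  have hsub : ∀ x ∈ Icc (m' : ℝ) n', φ x = c + s * x := fun x hx =>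
    hcs x ⟨le_trans (by exact_mod_cast hmm') hx.1, hx.2.trans (by exact_mod_cast hn'n)⟩
  obtain ⟨y, hy⟩ := hk
  obtain ⟨y', hy'⟩ := hk'
  have d1 := det_eq_one hf hll hrr hlt hno (by omega) hm'k hkn' (by omega) ha' hb' hsub hcons hy
  have d2 := det_eq_one hf hll hrr hlt hno (by omega) (by omega) hk'n' (by omega) ha' hb' hsub
    hcons hy'
  have hm'n' : (m' : ℝ) < n' := by exact_mod_cast hm'k.trans_lt hkn'
  -- Both upper points have height one, so their difference is parallel to the base. Added to the
  -- left end of the base it gives a lattice point strictly inside a segment that has none.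
  refine hcons (m' + (k' - k)) (by omega) (by omega) (a' + (y' - y)) ?_
  have e1 := hsub m' ⟨le_rfl, hm'n'.le⟩
  have e2 := hsub n' ⟨hm'n'.le, le_rfl⟩
  rw [ha'] at e1
  rw [hb'] at e2
  have e3 := hsub ((m' + (k' - k) : ℤ) : ℝ) ⟨by exact_mod_cast (by omega : m' ≤ m' + (k' - k)),
    by exact_mod_cast (by omega : m' + (k' - k) ≤ n')⟩
  have d3 : (n' - m') * (y' - y) = (b' - a') * (k' - k) := by linear_combination d2 - d1
  have d3R : ((n' : ℝ) - m') * (y' - y) = (b' - a') * (k' - k) := by exact_mod_cast d3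
  have hne : (n' : ℝ) - m' ≠ 0 := by linarith
  rw [e3]
  push_cast
  apply mul_left_cancel₀ hne
  rw [mul_add (_ : ℝ) (a' : ℝ), d3R, e1, e2]
  ring

theorem chi_eq_one {x : ℝ} (h : ∃ y : ℤ, x = y) : chi x = 1 := by
  obtain ⟨y, rfl⟩ := h
  simp [chi]

theorem chi_eq_zero {x : ℝ} (h : ¬ ∃ y : ℤ, x = y) : chi x = 0 := by
  have h1 : (⌊x⌋ : ℝ) < x := lt_of_le_of_ne (Int.floor_le x) fun e => h ⟨_, e.symm⟩
  have h2 : ⌊x⌋ < ⌈x⌉ := Int.lt_ceil.2 h1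
  have h3 := Int.ceil_le_floor_add_one x
  unfold chi
  omega

theorem sum_chi (I : Finset ℤ) (f : ℝ → ℝ) [DecidablePred fun k : ℤ => ∃ y : ℤ, f k = y] :
    ∑ k ∈ I, chi (f k) = (I.filter fun k : ℤ => ∃ y : ℤ, f k = y).card := by
  rw [Finset.card_filter]
  push_cast
  refine Finset.sum_congr rfl fun k _ => ?_
  split_ifs with h
  · rw [chi_eq_one h]
  · rw [chi_eq_zero h]

/-- The upper roof has at most as many lattice points as the lower one. -/
theorem sum_chi_le {f φ : ℝ → ℝ} {l r l' r' : ℤ}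
    (hf : ConcaveOn ℝ (Icc (l : ℝ) r) f) (hφ : Roof φ l' r') (hll : l ≤ l') (hrr : r' ≤ r)
    (hlt : ∀ x ∈ Icc (l' : ℝ) r', φ x < f x)
    (hno : ∀ k y : ℤ, l' ≤ k → k ≤ r' → φ k < y → (y : ℝ) < f k → False) :
    ∑ k ∈ Finset.Icc l' r', chi (f k) ≤ ∑ k ∈ Finset.Icc l' r', chi (φ k) := by
  classical
  rw [sum_chi, sum_chi]
  norm_cast
  -- Assign to a lattice point of the upper roof the last lattice point of the lower roof in its
  -- column or to the left; `exists_node_between` makes this strictly increasing.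
  have hex : ∀ k ∈ (Finset.Icc l' r').filter (fun k : ℤ => ∃ y : ℤ, f k = y),
      ∃ j : ℤ, (l' ≤ j ∧ j ≤ k ∧ ∃ z : ℤ, φ j = z) ∧
        ∀ i : ℤ, (l' ≤ i ∧ i ≤ k ∧ ∃ z : ℤ, φ i = z) → i ≤ j := by
    intro k hk
    obtain ⟨h1, h2⟩ := Finset.mem_filter.1 hk
    obtain ⟨h3, h4⟩ := Finset.mem_Icc.1 h1
    exact Int.exists_greatest_of_bdd (P := fun j => l' ≤ j ∧ j ≤ k ∧ ∃ z : ℤ, φ j = z)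
      ⟨k, fun j hj => hj.2.1⟩ ⟨l', le_rfl, h3, hφ.left⟩
  choose! F hF1 hF2 using hex
  refine Finset.card_le_card_of_injOn F (fun k hk => ?_) ?_
  · obtain ⟨h3, h4⟩ := Finset.mem_Icc.1 (Finset.mem_filter.1 hk).1
    obtain ⟨h5, h6, h7⟩ := hF1 k hk
    exact Finset.mem_filter.2 ⟨Finset.mem_Icc.2 ⟨h5, by omega⟩, h7⟩
  · have key : ∀ k ∈ (Finset.Icc l' r').filter (fun k : ℤ => ∃ y : ℤ, f k = y),
        ∀ k' ∈ (Finset.Icc l' r').filter (fun k : ℤ => ∃ y : ℤ, f k = y), k < k' →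
        F k < F k' := by
      intro k hk k' hk' hkk
      obtain ⟨h1, h2⟩ := Finset.mem_filter.1 hk
      obtain ⟨h3, h4⟩ := Finset.mem_filter.1 hk'
      obtain ⟨j, hj1, hj2, hj3⟩ := exists_node_between hf hφ hll hrr hlt hno
        (Finset.mem_Icc.1 h1).1 hkk (Finset.mem_Icc.1 h3).2 h2 h4
      have := hF2 k' hk' j ⟨by linarith [(Finset.mem_Icc.1 h1).1], hj2, hj3⟩
      have := (hF1 k hk).2.1
      omega
    intro k hk k' hk' he
    rcases lt_trichotomy k k' with h | h | h
    · exact absurd he (key k hk k' hk' h).ne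
    · exact h
    · exact absurd he (key k' hk' k hk h).ne'

/-! ### Pick's theorem -/

theorem Roof.integral_unit {f : ℝ → ℝ} {l r : ℤ} (h : Roof f l r) {k : ℤ} (h1 : l ≤ k)
    (h2 : k < r) : IntervalIntegrable f volume k ((k + 1 : ℤ) : ℝ) ∧
      ∫ x in (k : ℝ)..((k + 1 : ℤ) : ℝ), f x = (f k + f ((k + 1 : ℤ) : ℝ)) / 2 := by
  obtain ⟨m, n, -, hmk, hkn, -, -, c, s, hcs⟩ := h.node k h1 h2
  have hk : (k : ℝ) ≤ ((k + 1 : ℤ) : ℝ) := by push_cast; linarith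
  have hmk' : (m : ℝ) ≤ k := by exact_mod_cast hmk
  have hkn' : ((k + 1 : ℤ) : ℝ) ≤ n := by exact_mod_cast hkn
  have heq : EqOn (fun x => c + s * x) f (uIcc (k : ℝ) ((k + 1 : ℤ) : ℝ)) := by
    intro x hx
    rw [uIcc_of_le hk] at hx
    exact (hcs x ⟨hmk'.trans hx.1, hx.2.trans hkn'⟩).symm
  have hint : IntervalIntegrable (fun x : ℝ => c + s * x) volume k ((k + 1 : ℤ) : ℝ) :=
    Continuous.intervalIntegrable (by fun_prop) _ _
  refine ⟨hint.congr (heq.mono uIoc_subset_uIcc), ?_⟩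
  rw [← intervalIntegral.integral_congr heq, ← heq left_mem_uIcc, ← heq right_mem_uIcc,
    intervalIntegral.integral_add (by simp) (Continuous.intervalIntegrable (by fun_prop) _ _),
    intervalIntegral.integral_const_mul, integral_id, intervalIntegral.integral_const]
  simp only [smul_eq_mul]
  push_cast
  ring

theorem Roof.integral {f : ℝ → ℝ} {l r : ℤ} (h : Roof f l r) {n : ℤ} (h1 : l ≤ n) :
    n ≤ r → IntervalIntegrable f volume l n ∧
      ∫ x in (l : ℝ)..n, f x = ∑ k ∈ Finset.Ico l n, f k + (f n - f l) / 2 := by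
  induction n, h1 using Int.leInduction with
  | base => simp
  | succ n hn ih =>
    intro hnr
    obtain ⟨i1, e1⟩ := ih (by omega)
    obtain ⟨i2, e2⟩ := h.integral_unit hn (by omega)
    refine ⟨i1.trans i2, ?_⟩
    have e : Finset.Ico l (n + 1) = insert n (Finset.Ico l n) := by
      ext k
      simp only [Finset.mem_Ico, Finset.mem_insert]
      omega
    rw [← intervalIntegral.integral_add_adjacent_intervals i1 i2, e1, e2, e,
      Finset.sum_insert (by simp)]
    ring

/-- The sawtooth function. -/
noncomputable def sawtooth (x : ℝ) : ℝ := x - (⌊x⌋ + ⌈x⌉) / 2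

theorem sawtooth_int_sub (a : ℤ) (x : ℝ) : sawtooth (a - x) = -sawtooth x := by
  have h1 : ⌊(a : ℝ) - x⌋ = a - ⌈x⌉ := by
    rw [sub_eq_add_neg, Int.floor_intCast_add, Int.floor_neg]; ring
  have h2 : ⌈(a : ℝ) - x⌉ = a - ⌊x⌋ := by
    rw [sub_eq_add_neg, Int.ceil_intCast_add, Int.ceil_neg]; ring
  unfold sawtooth
  rw [h1, h2]
  push_cast
  ring

theorem sawtooth_int (a : ℤ) : sawtooth a = 0 := by simp [sawtooth]

/-- The half turn about the midpoint of a lattice segment changes the sign of the sawtooth, so each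
segment sums to zero. The induction on `d` removes the last segment. -/
theorem Roof.sum_sawtooth_of_int {f : ℝ → ℝ} {l r : ℤ} (h : Roof f l r) (d : ℕ) :
    ∀ n : ℤ, l ≤ n → n ≤ r → n - l ≤ d → (∃ a : ℤ, f n = a) →
      ∑ k ∈ Finset.Ico l n, sawtooth (f k) = 0 := by
  induction d with
  | zero =>
    intro n h1 _ h3 _
    obtain rfl : n = l := by omega
    simp
  | succ d ih =>
    rintro n h1 h2 h3 ⟨b, hb⟩
    rcases h1.eq_or_lt with rfl | hlt
    · simp
    obtain ⟨m, n', hlm, hmn, hnn', hn'r, ⟨a, -, ha, -⟩, c, s, hcs⟩ :=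
      h.node (n - 1) (by omega) (by omega)
    have e0 := ih m hlm (by omega) (by push_cast at h3; omega) ⟨a, ha⟩
    rw [← Finset.Ico_union_Ico_eq_Ico hlm (by omega : m ≤ n),
      Finset.sum_union (Finset.Ico_disjoint_Ico_consecutive _ _ _), e0, zero_add]
    have hm : sawtooth (f m) = 0 := by rw [ha, sawtooth_int]
    have e1 : Finset.Ico m n = insert m (Finset.Ioo m n) := by
      ext k
      simp only [Finset.mem_Ico, Finset.mem_insert, Finset.mem_Ioo]
      omega
    rw [e1, Finset.sum_insert (by simp), hm, zero_add]
    have hrefl : ∑ k ∈ Finset.Ioo m n, sawtooth (f k)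
        = ∑ k ∈ Finset.Ioo m n, -sawtooth (f k) := by
      refine Finset.sum_nbij' (fun k => m + n - k) (fun k => m + n - k) ?_ ?_ ?_ ?_ ?_
      · intro k hk; simp only [Finset.mem_Ioo] at hk ⊢; omega
      · intro k hk; simp only [Finset.mem_Ioo] at hk ⊢; omega
      · intro k _; ring
      · intro k _; ring
      · intro k hk
        rw [Finset.mem_Ioo] at hk
        have hI : ∀ j : ℤ, m ≤ j → j ≤ n → f j = c + s * j := fun j h4 h5 =>
          hcs j ⟨by exact_mod_cast h4, by exact_mod_cast (by omega : j ≤ n')⟩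
        have : f k = ((a + b : ℤ) : ℝ) - f ((m + n - k : ℤ) : ℝ) := by
          push_cast
          rw [← ha, ← hb, hI k (by omega) (by omega), hI m le_rfl (by omega),
            hI n (by omega) le_rfl]
          have := hI (m + n - k) (by omega) (by omega)
          push_cast at this
          rw [this]
          ring
        rw [this, sawtooth_int_sub]
    rw [Finset.sum_neg_distrib] at hrefl
    linarith

theorem Ico_eq_insert {l r : ℤ} (hlr : l < r) : Finset.Ico l r = insert l (Finset.Ioo l r) := by
  ext k
  simp only [Finset.mem_Ico, Finset.mem_insert, Finset.mem_Ioo]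
  omega

theorem Roof.sum_sawtooth {f : ℝ → ℝ} {l r : ℤ} (h : Roof f l r) (hlr : l < r) :
    ∑ k ∈ Finset.Ioo l r, sawtooth (f k) = 0 := by
  have h1 := h.sum_sawtooth_of_int (r - l).toNat r hlr.le le_rfl (by omega) h.right
  rw [Ico_eq_insert hlr, Finset.sum_insert (by simp)] at h1
  obtain ⟨a, ha⟩ := h.left
  rwa [ha, sawtooth_int, zero_add] at h1

/-- The trapezoid rule is exact here, and the vanishing sawtooth sum lets each inner value be
replaced by the mean of its floor and ceiling. -/
theorem Roof.integral_eq {f : ℝ → ℝ} {l r : ℤ} (h : Roof f l r) (hlr : l < r) :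
    ∫ x in (l : ℝ)..r, f x =
      ∑ k ∈ Finset.Ioo l r, ((⌊f k⌋ + ⌈f k⌉ : ℤ) : ℝ) / 2 + (f l + f r) / 2 := by
  have h1 := (h.integral hlr.le le_rfl).2
  rw [Ico_eq_insert hlr, Finset.sum_insert (by simp)] at h1
  have h2 := h.sum_sawtooth hlr
  simp only [sawtooth, Finset.sum_sub_distrib] at h2
  push_cast
  linarith

/-- A convex set has null frontier, so the area can be taken over the interior, the region between
two graphs. -/
theorem area_eq_integral {K : Set (ℝ × ℝ)} {l r : ℤ} {f g : ℝ → ℝ} (h : Strip K l r f g)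
    (hne : (interior K).Nonempty) :
    area K = ∫ x in (l : ℝ)..r, f x + -g x := by
  obtain ⟨hlr, hlt⟩ := h.lt_of_interior hne
  have hlr' : (l : ℝ) ≤ r := by exact_mod_cast hlr.le
  have hfi := (h.roof.integral hlr.le le_rfl).1
  have hgi := (h.floor.integral hlr.le le_rfl).1
  rw [intervalIntegrable_iff_integrableOn_Ioo_of_le hlr'] at hfi hgi
  have hgi' : IntegrableOn g (Ioo (l : ℝ) r) volume := by simpa using hgi.neg
  have e : interior K = regionBetween g f (Ioo (l : ℝ) r) := h.interior_eq
  rw [area, ← measure_congr (interior_ae_eq_of_null_frontier (h.convex.addHaar_frontier volume)),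
    e, Measure.volume_eq_prod, volume_regionBetween_eq_integral hgi' hfi measurableSet_Ioo
      (fun x hx => (hlt x hx).le), ENNReal.toReal_ofReal
      (setIntegral_nonneg measurableSet_Ioo fun x hx => by
        simpa using (hlt x hx).le),
    intervalIntegral.integral_of_le hlr', integral_Ioc_eq_integral_Ioo]
  rfl

theorem Strip.pick {K : Set (ℝ × ℝ)} {l r : ℤ} {f g : ℝ → ℝ} (h : Strip K l r f g)
    (hc : IsClosed K) (hne : (interior K).Nonempty) :
    area K = interiorPoints K + (boundaryPoints K : ℝ) / 2 - 1 := by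
  obtain ⟨hlr, -⟩ := h.lt_of_interior hne
  have hi : (interiorPoints K : ℝ) = ((∑ k ∈ Finset.Ioo l r, (⌈f k⌉ - ⌊g k⌋ - 1) : ℤ) : ℝ) := by
    exact_mod_cast h.interiorPoints_eq hne
  have hb : (boundaryPoints K : ℝ) = ((∑ k ∈ Finset.Ioo l r, (chi (f k) + chi (g k)) +
      (⌊f l⌋ - ⌈g l⌉ + 1) + (⌊f r⌋ - ⌈g r⌉ + 1) : ℤ) : ℝ) := by
    exact_mod_cast h.boundaryPoints_eq hc hne
  rw [area_eq_integral h hne, intervalIntegral.integral_add (h.roof.integral hlr.le le_rfl).1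
    (h.floor.integral hlr.le le_rfl).1, h.roof.integral_eq hlr, h.floor.integral_eq hlr, hi, hb]
  obtain ⟨a, ha⟩ := h.roof.left
  obtain ⟨b, hb⟩ := h.roof.right
  obtain ⟨c, hc⟩ := h.floor.left
  obtain ⟨d, hd⟩ := h.floor.right
  have hc' : g l = ((-c : ℤ) : ℝ) := by push_cast; linarith
  have hd' : g r = ((-d : ℤ) : ℝ) := by push_cast; linarith
  -- Pick's formula holds column by column: interior points plus half the boundary points.
  have hs : ∑ k ∈ Finset.Ioo l r, ((⌊f k⌋ + ⌈f k⌉ : ℤ) : ℝ) / 2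
      + ∑ k ∈ Finset.Ioo l r, ((⌊-g k⌋ + ⌈-g k⌉ : ℤ) : ℝ) / 2 =
      ((∑ k ∈ Finset.Ioo l r, (⌈f k⌉ - ⌊g k⌋ - 1) : ℤ) : ℝ)
      + ((∑ k ∈ Finset.Ioo l r, (chi (f k) + chi (g k)) : ℤ) : ℝ) / 2 := by
    rw [Int.cast_sum, Int.cast_sum, Finset.sum_div, ← Finset.sum_add_distrib,
      ← Finset.sum_add_distrib]
    refine Finset.sum_congr rfl fun k _ => ?_
    rw [Int.floor_neg, Int.ceil_neg]
    unfold chi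
    push_cast
    ring
  rw [ha, hb, hc', hd', Int.floor_intCast, Int.floor_intCast, Int.ceil_intCast, Int.ceil_intCast]
  push_cast at hs ⊢
  linarith

/-! ### Lattice equivalence -/

theorem image_interior (Φ : (ℝ × ℝ) ≃ᵃ[ℝ] (ℝ × ℝ)) (P : Set (ℝ × ℝ)) :
    Φ '' interior P = interior (Φ '' P) :=
  (AffineEquiv.toContinuousAffineEquiv Φ).toHomeomorph.image_interior P

theorem image_frontier (Φ : (ℝ × ℝ) ≃ᵃ[ℝ] (ℝ × ℝ)) (P : Set (ℝ × ℝ)) :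
    Φ '' frontier P = frontier (Φ '' P) :=
  (AffineEquiv.toContinuousAffineEquiv Φ).toHomeomorph.image_frontier P

theorem image_interior_lattice {Φ : (ℝ × ℝ) ≃ᵃ[ℝ] (ℝ × ℝ)} (hΦ : Φ '' lattice = lattice)
    (P : Set (ℝ × ℝ)) : Φ '' (interior P ∩ lattice) = interior (Φ '' P) ∩ lattice := by
  rw [image_inter Φ.injective, image_interior, hΦ]

theorem interiorPoints_image {Φ : (ℝ × ℝ) ≃ᵃ[ℝ] (ℝ × ℝ)} (hΦ : Φ '' lattice = lattice)
    (P : Set (ℝ × ℝ)) : interiorPoints (Φ '' P) = interiorPoints P := by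
  rw [interiorPoints, ← image_interior_lattice hΦ, ncard_image_of_injective _ Φ.injective]
  rfl

theorem boundaryPoints_image {Φ : (ℝ × ℝ) ≃ᵃ[ℝ] (ℝ × ℝ)} (hΦ : Φ '' lattice = lattice)
    (P : Set (ℝ × ℝ)) : boundaryPoints (Φ '' P) = boundaryPoints P := by
  rw [boundaryPoints, ← image_frontier]
  nth_rewrite 1 [← hΦ]
  rw [← image_inter Φ.injective, ncard_image_of_injective _ Φ.injective]
  rfl

theorem peel_image {Φ : (ℝ × ℝ) ≃ᵃ[ℝ] (ℝ × ℝ)} (hΦ : Φ '' lattice = lattice)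
    (P : Set (ℝ × ℝ)) : peel (Φ '' P) = Φ '' peel P := by
  rw [peel, ← image_interior_lattice hΦ]
  exact (Φ.toAffineMap.image_convexHull _).symm

theorem IsConvexLatticePolygon.image {Φ : (ℝ × ℝ) ≃ᵃ[ℝ] (ℝ × ℝ)} (hΦ : Φ '' lattice = lattice)
    {P : Set (ℝ × ℝ)} (hP : IsConvexLatticePolygon P) : IsConvexLatticePolygon (Φ '' P) := by
  classical
  obtain ⟨⟨V, hV, rfl⟩, hne⟩ := hP
  refine ⟨⟨V.image Φ, ?_, ?_⟩, ?_⟩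
  · rw [Finset.coe_image, ← hΦ]
    exact image_mono hV
  · rw [Finset.coe_image]
    exact Φ.toAffineMap.image_convexHull _
  · rw [← image_interior]
    exact hne.image _

theorem LatticeEquivalent.interiorPoints_eq {P Q : Set (ℝ × ℝ)} (h : LatticeEquivalent P Q) :
    interiorPoints P = interiorPoints Q := by
  obtain ⟨Φ, hΦ, rfl⟩ := h
  exact (interiorPoints_image hΦ P).symm

theorem LatticeEquivalent.boundaryPoints_eq {P Q : Set (ℝ × ℝ)} (h : LatticeEquivalent P Q) :
    boundaryPoints P = boundaryPoints Q := by
  obtain ⟨Φ, hΦ, rfl⟩ := h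
  exact (boundaryPoints_image hΦ P).symm

theorem LatticeEquivalent.peel {P Q : Set (ℝ × ℝ)} (h : LatticeEquivalent P Q) :
    LatticeEquivalent (peel P) (LatticePolygon.peel Q) := by
  obtain ⟨Φ, hΦ, rfl⟩ := h
  exact ⟨Φ, hΦ, (peel_image hΦ P).symm⟩

theorem LatticeEquivalent.interior_nonempty {P Q : Set (ℝ × ℝ)} (h : LatticeEquivalent P Q)
    (hP : (interior P).Nonempty) : (interior Q).Nonempty := by
  obtain ⟨Φ, hΦ, rfl⟩ := h
  rw [← image_interior]
  exact hP.image _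

theorem LatticeEquivalent.trans {P Q R : Set (ℝ × ℝ)} (h : LatticeEquivalent P Q)
    (h' : LatticeEquivalent Q R) : LatticeEquivalent P R := by
  obtain ⟨Φ, hΦ, rfl⟩ := h
  obtain ⟨Ψ, hΨ, rfl⟩ := h'
  refine ⟨Φ.trans Ψ, ?_, ?_⟩ <;> rw [AffineEquiv.coe_trans, image_comp]
  rw [hΦ, hΨ]

/-- The linear automorphism with a unimodular integer matrix. -/
noncomputable def unimodular (a b c d ε : ℤ) (h : a * d - b * c = ε) (hε : ε * ε = 1) :
    (ℝ × ℝ) ≃ₗ[ℝ] (ℝ × ℝ) :=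
  have h1 : (ε : ℝ) * (a * d - b * c) = 1 := by rw [← h] at hε ⊢; exact_mod_cast hε
  { toFun := fun p => (a * p.1 + b * p.2, c * p.1 + d * p.2)
    map_add' := fun p q => by ext <;> simp <;> ring
    map_smul' := fun t p => by ext <;> simp <;> ring
    invFun := fun p => (ε * (d * p.1 - b * p.2), ε * (a * p.2 - c * p.1))
    left_inv := fun p => by
      ext
      · simp only; linear_combination p.1 * h1
      · simp only; linear_combination p.2 * h1
    right_inv := fun p => by
      ext
      · simp only; linear_combination p.1 * h1
      · simp only; linear_combination p.2 * h1 }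

theorem exists_lattice_automorphism (a b c d ε s t : ℤ) (h : a * d - b * c = ε)
    (hε : ε * ε = 1) : ∃ Φ : (ℝ × ℝ) ≃ᵃ[ℝ] (ℝ × ℝ), Φ '' lattice = lattice ∧
      ∀ p, Φ p = (a * p.1 + b * p.2 + s, c * p.1 + d * p.2 + t) := by
  refine ⟨(unimodular a b c d ε h hε).toAffineEquiv.trans
    (AffineEquiv.constVAdd ℝ (ℝ × ℝ) ((s : ℝ), (t : ℝ))), ?_, ?_⟩
  · have hval : ∀ p, ((unimodular a b c d ε h hε).toAffineEquiv.trans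
        (AffineEquiv.constVAdd ℝ (ℝ × ℝ) ((s : ℝ), (t : ℝ)))) p =
        (a * p.1 + b * p.2 + s, c * p.1 + d * p.2 + t) := by
      intro p
      ext <;> simp [unimodular] <;> ring
    apply Subset.antisymm
    · rintro _ ⟨_, ⟨x, y, rfl⟩, rfl⟩
      rw [hval]
      exact ⟨a * x + b * y + s, c * x + d * y + t, by push_cast; rfl⟩
    · rintro _ ⟨x, y, rfl⟩
      refine ⟨(((ε * (d * (x - s) - b * (y - t)) : ℤ) : ℝ),
        ((ε * (a * (y - t) - c * (x - s)) : ℤ) : ℝ)), ⟨_, _, rfl⟩, ?_⟩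
      rw [hval]
      have h1 : (ε : ℝ) * (a * d - b * c) = 1 := by rw [← h] at hε ⊢; exact_mod_cast hε
      push_cast
      ext
      · simp only; linear_combination ((x : ℝ) - s) * h1
      · simp only; linear_combination ((y : ℝ) - t) * h1
  · intro p
    ext <;> simp [unimodular] <;> ring

/-! ### Peeling a polygon whose outer columns are one step away from those of its peel -/

/-- Concavity gives `f l + f r ≤ f (l + 1) + f (r - 1)`, and each term on the right exceeds `φ` by
at most 1, or a lattice point would fit in between. The floors only turn integral values into
integers. -/
theorem roof_ends_le {f φ : ℝ → ℝ} {l r : ℤ}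
    (hf : Roof f l r) (hφ : Roof φ (l + 1) (r - 1)) (hlr : l + 1 ≤ r - 1)
    (hno : ∀ k y : ℤ, l + 1 ≤ k → k ≤ r - 1 → φ k < y → (y : ℝ) < f k → False) :
    ⌊f l⌋ + ⌊f r⌋ ≤ ⌊φ ((l + 1 : ℤ) : ℝ)⌋ + ⌊φ ((r - 1 : ℤ) : ℝ)⌋ + 2 := by
  obtain ⟨a, ha⟩ := hf.left
  obtain ⟨b, hb⟩ := hf.right
  obtain ⟨c, hc⟩ := hφ.left
  obtain ⟨d, hd⟩ := hφ.right
  rw [ha, hb, hc, hd]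
  simp only [Int.floor_intCast]
  have h1 : f ((l + 1 : ℤ) : ℝ) ≤ c + 1 := by
    by_contra! h
    exact hno (l + 1) (c + 1) le_rfl hlr (by rw [hc]; push_cast; linarith) (by push_cast at h ⊢; exact h)
  have h2 : f ((r - 1 : ℤ) : ℝ) ≤ d + 1 := by
    by_contra! h
    exact hno (r - 1) (d + 1) hlr le_rfl (by rw [hd]; push_cast; linarith) (by push_cast at h ⊢; exact h)
  have hlt : (l : ℝ) < r := by exact_mod_cast (by omega : l < r)
  have hlr' : (l : ℝ) + 1 ≤ r - 1 := by exact_mod_cast hlr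
  have hlI : (l : ℝ) ∈ Icc (l : ℝ) r := ⟨le_rfl, hlt.le⟩
  have hrI : (r : ℝ) ∈ Icc (l : ℝ) r := ⟨hlt.le, le_rfl⟩
  have c1 := concave_chord_le hf.concave hlI hrI hlt
    (show (((l + 1 : ℤ)) : ℝ) ∈ Icc (l : ℝ) r by push_cast; exact ⟨by linarith, by linarith⟩)
  have c2 := concave_chord_le hf.concave hlI hrI hlt
    (show (((r - 1 : ℤ)) : ℝ) ∈ Icc (l : ℝ) r by push_cast; exact ⟨by linarith, by linarith⟩)
  rw [ha, hb] at c1 c2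
  have hpos : (0 : ℝ) < r - l := by linarith
  have c3 : ((r : ℝ) - l) * (a + b) ≤ (r - l) * (c + d + 2) := by
    have e1 := mul_le_mul_of_nonneg_left h1 hpos.le
    have e2 := mul_le_mul_of_nonneg_left h2 hpos.le
    push_cast at c1 c2 e1 e2
    linarith
  have := le_of_mul_le_mul_left c3 hpos
  exact_mod_cast this

theorem chi_neg (x : ℝ) : chi (-x) = chi x := by
  unfold chi
  rw [Int.floor_neg, Int.ceil_neg]
  ring

theorem peel_subset_interior {P : Set (ℝ × ℝ)} (hP : Convex ℝ P) : peel P ⊆ interior P :=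
  convexHull_min inter_subset_left hP.interior

theorem peel_inter_lattice {P : Set (ℝ × ℝ)} (hP : Convex ℝ P) :
    peel P ∩ lattice = interior P ∩ lattice :=
  Subset.antisymm (inter_subset_inter_left _ (peel_subset_interior hP))
    fun _ hp => ⟨subset_convexHull ℝ _ hp, hp.2⟩

/-- The inner and outer strips of a polygon and its peel. -/
structure Layer (P : Set (ℝ × ℝ)) (l r : ℤ) (f g φ γ : ℝ → ℝ) : Prop where
  outer : Strip P l r f g
  closed : IsClosed P
  inner : Strip (peel P) (l + 1) (r - 1) φ γ

namespace Layer

variable {P : Set (ℝ × ℝ)} {l r : ℤ} {f g φ γ : ℝ → ℝ}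

theorem inner_mem (h : Layer P l r f g φ γ) {x y : ℝ}
    (hx : x ∈ Icc ((l + 1 : ℤ) : ℝ) ((r - 1 : ℤ) : ℝ)) (hy : y ∈ Icc (γ x) (φ x)) :
    g x < y ∧ y < f x := by
  have : ((x, y) : ℝ × ℝ) ∈ interior P :=
    peel_subset_interior h.outer.convex ((h.inner.mem_iff _).2 ⟨hx, hy⟩)
  rw [h.outer.interior_eq] at this
  exact this.2

theorem roof_lt (h : Layer P l r f g φ γ) :
    ∀ x ∈ Icc ((l + 1 : ℤ) : ℝ) ((r - 1 : ℤ) : ℝ), φ x < f x :=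
  fun x hx => (h.inner_mem hx ⟨h.inner.g_le x hx, le_rfl⟩).2

theorem lt_floor (h : Layer P l r f g φ γ) :
    ∀ x ∈ Icc ((l + 1 : ℤ) : ℝ) ((r - 1 : ℤ) : ℝ), g x < γ x :=
  fun x hx => (h.inner_mem hx ⟨le_rfl, h.inner.g_le x hx⟩).1

theorem mem_inner (h : Layer P l r f g φ γ) {k y : ℤ} (h1 : l + 1 ≤ k) (h2 : k ≤ r - 1)
    (h3 : g k < y) (h4 : (y : ℝ) < f k) : (y : ℝ) ∈ Icc (γ k) (φ k) := by
  have : (((k : ℝ), (y : ℝ)) : ℝ × ℝ) ∈ interior P ∩ lattice := by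
    refine ⟨?_, k, y, rfl⟩
    rw [h.outer.interior_eq]
    exact ⟨⟨Int.cast_lt.2 (show l < k by omega), Int.cast_lt.2 (show k < r by omega)⟩, h3, h4⟩
  rw [← peel_inter_lattice h.outer.convex] at this
  exact ((h.inner.mem_iff _).1 this.1).2

theorem cast_mem {k : ℤ} (h1 : l + 1 ≤ k) (h2 : k ≤ r - 1) :
    (k : ℝ) ∈ Icc ((l + 1 : ℤ) : ℝ) ((r - 1 : ℤ) : ℝ) :=
  ⟨by exact_mod_cast h1, by exact_mod_cast h2⟩

theorem not_between_roofs (h : Layer P l r f g φ γ) (k y : ℤ) (h1 : l + 1 ≤ k) (h2 : k ≤ r - 1)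
    (h3 : φ k < y) (h4 : (y : ℝ) < f k) : False := by
  have hk := cast_mem h1 h2
  have := (h.mem_inner h1 h2 (((h.lt_floor k hk).trans_le (h.inner.g_le k hk)).trans h3) h4).2
  linarith

theorem not_between_floors (h : Layer P l r f g φ γ) (k y : ℤ) (h1 : l + 1 ≤ k) (h2 : k ≤ r - 1)
    (h3 : -γ k < y) (h4 : (y : ℝ) < -g k) : False := by
  have hk := cast_mem h1 h2
  have h5 := (h.inner.g_le k hk).trans_lt (h.roof_lt k hk)
  have := (h.mem_inner (y := -y) h1 h2 (by push_cast; linarith) (by push_cast; linarith)).1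
  push_cast at this
  linarith

/-- Inner columns are compared by `sum_chi_le`, applied to the roofs and to the negated floors. In
the outer columns `roof_ends_le` costs 2 for the roofs and 2 for the floors, and each column adds 1
for counting points instead of length: 6 in all. -/
theorem boundaryPoints_le (h : Layer P l r f g φ γ) (hne : (interior P).Nonempty) :
    (boundaryPoints P : ℤ) ≤ ∑ k ∈ Finset.Icc (l + 1) (r - 1), (chi (φ k) + chi (γ k)) +
      (⌊φ ((l + 1 : ℤ) : ℝ)⌋ - ⌈γ ((l + 1 : ℤ) : ℝ)⌉) +
      (⌊φ ((r - 1 : ℤ) : ℝ)⌋ - ⌈γ ((r - 1 : ℤ) : ℝ)⌉) + 6 := by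
  have hlr := h.inner.le
  rw [h.outer.boundaryPoints_eq h.closed hne]
  have s1 := sum_chi_le h.outer.roof.concave h.inner.roof (by omega) (by omega) h.roof_lt
    h.not_between_roofs
  have s2 := sum_chi_le h.outer.floor.concave h.inner.floor (by omega) (by omega)
    (fun x hx => neg_lt_neg (h.lt_floor x hx)) h.not_between_floors
  have e1 := roof_ends_le h.outer.roof h.inner.roof hlr h.not_between_roofs
  have e2 := roof_ends_le h.outer.floor h.inner.floor hlr h.not_between_floors
  simp only [chi_neg] at s2
  simp only [Int.floor_neg] at e2
  have hI : Finset.Ioo l r = Finset.Icc (l + 1) (r - 1) := by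
    ext k
    simp only [Finset.mem_Icc, Finset.mem_Ioo]
    omega
  rw [hI, Finset.sum_add_distrib, Finset.sum_add_distrib]
  linarith

theorem chi_ends (h : Layer P l r f g φ γ) :
    chi (φ ((l + 1 : ℤ) : ℝ)) = 1 ∧ chi (φ ((r - 1 : ℤ) : ℝ)) = 1 ∧
    chi (γ ((l + 1 : ℤ) : ℝ)) = 1 ∧ chi (γ ((r - 1 : ℤ) : ℝ)) = 1 := by
  refine ⟨chi_eq_one h.inner.roof.left, chi_eq_one h.inner.roof.right, ?_, ?_⟩
  · rw [← chi_neg]; exact chi_eq_one h.inner.floor.left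
  · rw [← chi_neg]; exact chi_eq_one h.inner.floor.right

theorem closed_peel (h : Layer P l r f g φ γ) : IsClosed (peel P) := by
  have hfin : (interior P ∩ lattice).Finite :=
    h.outer.finite_lattice.subset (inter_subset_inter_left _ interior_subset)
  exact (hfin.isCompact_convexHull ℝ).isClosed

/-- A two-dimensional peel has at most eight boundary points less. -/
theorem boundaryPoints_le_peel (h : Layer P l r f g φ γ) (hne : (interior P).Nonempty)
    (hne' : (interior (peel P)).Nonempty) :
    boundaryPoints P ≤ boundaryPoints (peel P) + 8 := by
  have h1 := h.boundaryPoints_le hne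
  have h2 := h.inner.boundaryPoints_eq h.closed_peel hne'
  rw [Strip.sum_Icc_eq (h.inner.lt_of_interior hne').1] at h1
  obtain ⟨c1, c2, c3, c4⟩ := h.chi_ends
  -- The bound for P counts four end nodes separately, whereas the peel's own count has `+ 1` at
  -- each end: 6 + 4 - 2 = 8.
  rw [c1, c2, c3, c4] at h1
  omega

/-- An integral end is itself a point of the column; the factor 2 is needed when both ends are the
same point. -/
theorem chi_add_chi_le {x y : ℝ} (h : y ≤ x) : chi x + chi y ≤ 2 * (⌊x⌋ - ⌈y⌉ + 1) := by
  have h1 : ⌊y⌋ ≤ ⌊x⌋ := Int.floor_le_floor h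
  have h2 : ⌈y⌉ ≤ ⌈x⌉ := Int.ceil_le_ceil h
  have h3 := Int.ceil_le_floor_add_one y
  have h4 := Int.ceil_le_floor_add_one x
  unfold chi
  omega

/-- Scott's inequality for a polygon in such a position. -/
theorem scott (h : Layer P l r f g φ γ) (hne : (interior P).Nonempty) :
    boundaryPoints P ≤ 2 * interiorPoints P + 6 := by
  have h1 := h.boundaryPoints_le hne
  have h2 := h.inner.lattice_ncard
  rw [peel_inter_lattice h.outer.convex] at h2
  change (interiorPoints P : ℤ) = _ at h2
  obtain ⟨c1, c2, c3, c4⟩ := h.chi_ends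
  rcases h.inner.le.eq_or_lt with he | hlt
  · rw [← he] at h1 h2
    simp only [Finset.Icc_self, Finset.sum_singleton] at h1 h2
    rw [c1, c3] at h1
    omega
  · rw [Strip.sum_Icc_eq hlt] at h1 h2
    rw [c1, c2, c3, c4] at h1
    have h3 : ∑ k ∈ Finset.Ioo (l + 1) (r - 1), (chi (φ k) + chi (γ k)) ≤
        2 * ∑ k ∈ Finset.Ioo (l + 1) (r - 1), (⌊φ k⌋ - ⌈γ k⌉ + 1) := by
      rw [Finset.mul_sum]
      refine Finset.sum_le_sum fun k hk => chi_add_chi_le (h.inner.g_le_int ?_)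
      exact Finset.Ioo_subset_Icc_self hk
    have g1 := h.inner.g_le_int (k := l + 1) (by simp; omega)
    have g2 := h.inner.g_le_int (k := r - 1) (by simp; omega)
    -- Both end columns of the peel contain a lattice point; this absorbs the surplus of 1 that each
    -- of them contributes.
    have k1 := chi_add_chi_le g1
    have k2 := chi_add_chi_le g2
    rw [c1, c3] at k1
    rw [c2, c4] at k2
    omega

end Layer

/-! ### Positions of minimal width -/

theorem Strip.mem_left {K : Set (ℝ × ℝ)} {l r : ℤ} {f g : ℝ → ℝ} (h : Strip K l r f g) :
    ((l : ℝ), f l) ∈ K := by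
  have hl : (l : ℝ) ∈ Icc (l : ℝ) r := ⟨le_rfl, by exact_mod_cast h.le⟩
  exact (h.mem_iff _).2 ⟨hl, h.g_le _ hl, le_rfl⟩

theorem Strip.mem_right {K : Set (ℝ × ℝ)} {l r : ℤ} {f g : ℝ → ℝ} (h : Strip K l r f g) :
    ((r : ℝ), f r) ∈ K := by
  have hr : (r : ℝ) ∈ Icc (l : ℝ) r := ⟨by exact_mod_cast h.le, le_rfl⟩
  exact (h.mem_iff _).2 ⟨hr, h.g_le _ hr, le_rfl⟩

theorem IsConvexLatticePolygon.isClosed {P : Set (ℝ × ℝ)} (hP : IsConvexLatticePolygon P) :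
    IsClosed P := by
  obtain ⟨⟨V, hV, rfl⟩, -⟩ := hP
  exact (V.finite_toSet.isCompact_convexHull ℝ).isClosed

theorem IsConvexLatticePolygon.convex {P : Set (ℝ × ℝ)} (hP : IsConvexLatticePolygon P) :
    Convex ℝ P := by
  obtain ⟨⟨V, hV, rfl⟩, -⟩ := hP
  exact convex_convexHull ℝ _

theorem IsConvexLatticePolygon.exists_strip {P : Set (ℝ × ℝ)} (hP : IsConvexLatticePolygon P) :
    ∃ (l r : ℤ) (f g : ℝ → ℝ), Strip P l r f g := by
  obtain ⟨⟨V, hV, rfl⟩, hne⟩ := hP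
  refine Strip.exists_of_hull hV ?_
  by_contra h
  rw [Finset.not_nonempty_iff_eq_empty] at h
  subst h
  simp at hne

theorem mem_triangle {k : ℝ} (hk : 0 < k) {p : ℝ × ℝ} :
    p ∈ triangle k ↔ 0 ≤ p.1 ∧ 0 ≤ p.2 ∧ p.1 + p.2 ≤ k := by
  constructor
  · have hc : Convex ℝ {p : ℝ × ℝ | 0 ≤ p.1 ∧ 0 ≤ p.2 ∧ p.1 + p.2 ≤ k} := by
      rintro p ⟨h1, h2, h3⟩ q ⟨h4, h5, h6⟩ a b ha hb hab
      refine ⟨?_, ?_, ?_⟩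
      · simp only [Prod.fst_add, Prod.smul_fst, smul_eq_mul]; positivity
      · simp only [Prod.snd_add, Prod.smul_snd, smul_eq_mul]; positivity
      · simp only [Prod.fst_add, Prod.snd_add, Prod.smul_fst, Prod.smul_snd, smul_eq_mul]
        have e1 := mul_le_mul_of_nonneg_left h3 ha
        have e2 := mul_le_mul_of_nonneg_left h6 hb
        have e3 : a * k + b * k = k := by rw [← add_mul, hab, one_mul]
        linarith
    have hsub : triangle k ⊆ {p : ℝ × ℝ | 0 ≤ p.1 ∧ 0 ≤ p.2 ∧ p.1 + p.2 ≤ k} := by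
      refine convexHull_min ?_ hc
      rintro p (rfl | rfl | rfl) <;> simp [hk.le]
    exact fun hp => hsub hp
  · rintro ⟨h1, h2, h3⟩
    rw [triangle, convexHull_insert (by simp), mem_convexJoin]
    refine ⟨(0, 0), rfl, ?_⟩
    rw [convexHull_pair]
    by_cases h0 : p.1 + p.2 = 0
    · have e1 : p.1 = 0 := by linarith
      have e2 : p.2 = 0 := by linarith
      refine ⟨(k, 0), left_mem_segment _ _ _, ?_⟩
      have : p = (0, 0) := Prod.ext e1 e2
      rw [this]
      exact left_mem_segment _ _ _
    · have hs : 0 < p.1 + p.2 := lt_of_le_of_ne (by linarith) (Ne.symm h0)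
      refine ⟨(k * p.1 / (p.1 + p.2), k * p.2 / (p.1 + p.2)), ?_, ?_⟩
      · refine ⟨p.1 / (p.1 + p.2), p.2 / (p.1 + p.2), by positivity, by positivity,
          by rw [← add_div, div_self h0], ?_⟩
        ext <;> simp <;> ring
      · refine ⟨1 - (p.1 + p.2) / k, (p.1 + p.2) / k, ?_, by positivity, by ring, ?_⟩
        · rw [sub_nonneg, div_le_one hk]; exact h3
        · ext <;> simp <;> field_simp

/-- Every lattice automorphism makes the horizontal width of `P` at least `W`. -/
def MinWidth (P : Set (ℝ × ℝ)) (W : ℤ) : Prop :=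
  ∀ Ψ : (ℝ × ℝ) ≃ᵃ[ℝ] (ℝ × ℝ), Ψ '' lattice = lattice → ∀ c m : ℤ,
    (∀ p ∈ P, (c : ℝ) ≤ (Ψ p).1 ∧ (Ψ p).1 ≤ c + m) → W ≤ m

theorem MinWidth.image {P : Set (ℝ × ℝ)} {W : ℤ} (h : MinWidth P W)
    {Φ : (ℝ × ℝ) ≃ᵃ[ℝ] (ℝ × ℝ)} (hΦ : Φ '' lattice = lattice) : MinWidth (Φ '' P) W := by
  intro Ψ hΨ c m hcm
  refine h (Φ.trans Ψ) ?_ c m fun p hp => hcm _ (mem_image_of_mem _ hp)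
  rw [AffineEquiv.coe_trans, image_comp, hΦ, hΨ]

/-- The coordinate is integral at the vertices, so if it stayed below `c + W` it would stay below `c
+ W - 1` too, and the width would be less than `W`. -/
theorem MinWidth.exists_far {P : Set (ℝ × ℝ)} {W : ℤ} (h : MinWidth P W)
    (hP : IsConvexLatticePolygon P) {Ψ : (ℝ × ℝ) ≃ᵃ[ℝ] (ℝ × ℝ)} (hΨ : Ψ '' lattice = lattice)
    {c : ℤ} (hc : ∀ p ∈ P, (c : ℝ) ≤ (Ψ p).1) : ∃ v ∈ P, (c : ℝ) + W ≤ (Ψ v).1 := by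
  by_contra! hcon
  obtain ⟨⟨V, hV, rfl⟩, -⟩ := hP
  have hle : convexHull ℝ (V : Set (ℝ × ℝ)) ⊆
      Ψ ⁻¹' (Prod.fst ⁻¹' Iic ((c : ℝ) + (W - 1 : ℤ))) := by
    refine convexHull_min ?_ ?_
    · intro v hv
      have h1 := hcon v (subset_convexHull ℝ _ hv)
      have h2 : Ψ v ∈ lattice := by
        rw [← hΨ]; exact mem_image_of_mem _ (hV hv)
      obtain ⟨x, y, hxy⟩ := h2
      rw [hxy] at h1
      rw [mem_preimage, hxy]
      simp only at h1
      have h3 : x < c + W := by exact_mod_cast h1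
      have h4 : x ≤ c + (W - 1) := by omega
      change (x : ℝ) ≤ c + (W - 1 : ℤ)
      exact_mod_cast h4
    · exact ((convex_Iic _).linear_preimage (LinearMap.fst ℝ ℝ ℝ)).affine_preimage Ψ.toAffineMap
  have := h Ψ hΨ c (W - 1) fun p hp => ⟨hc p hp, hle hp⟩
  omega

/-- The integral widths over all lattice automorphisms are natural numbers, so one of them is least.
-/
theorem IsConvexLatticePolygon.exists_minWidth {P : Set (ℝ × ℝ)}
    (hP : IsConvexLatticePolygon P) :
    ∃ Q, LatticeEquivalent P Q ∧ IsConvexLatticePolygon Q ∧ ∃ (l r : ℤ) (f g : ℝ → ℝ),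
      Strip Q l r f g ∧ MinWidth Q (r - l) := by
  classical
  have hex : ∃ n : ℕ, ∃ Φ : (ℝ × ℝ) ≃ᵃ[ℝ] (ℝ × ℝ), Φ '' lattice = lattice ∧
      ∃ c : ℤ, ∀ p ∈ P, (c : ℝ) ≤ (Φ p).1 ∧ (Φ p).1 ≤ c + n := by
    obtain ⟨l, r, f, g, h⟩ := hP.exists_strip
    refine ⟨(r - l).toNat, AffineEquiv.refl ℝ _, by simp, l, fun p hp => ?_⟩
    have h1 := ((h.mem_iff p).1 hp).1
    have h2 : (((r - l).toNat : ℤ) : ℝ) = ((r - l : ℤ) : ℝ) := by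
      rw [Int.toNat_of_nonneg (by linarith [h.le])]
    refine ⟨h1.1, ?_⟩
    rw [← Int.cast_natCast (R := ℝ), h2]
    push_cast
    have := h1.2
    simp only [AffineEquiv.refl_apply]
    linarith
  obtain ⟨Φ, hΦ, c, hc⟩ := Nat.find_spec hex
  have hQ := hP.image hΦ
  obtain ⟨l, r, f, g, h⟩ := hQ.exists_strip
  refine ⟨Φ '' P, ⟨Φ, hΦ, rfl⟩, hQ, l, r, f, g, h, ?_⟩
  have hn : r - l ≤ Nat.find hex := by
    obtain ⟨p, hp, hpl⟩ := h.mem_left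
    obtain ⟨q, hq, hqr⟩ := h.mem_right
    have h1 := (hc p hp).1
    have h2 := (hc q hq).2
    rw [hpl] at h1
    rw [hqr] at h2
    simp only at h1 h2
    have h1' : c ≤ l := by exact_mod_cast h1
    have h2' : r ≤ c + (Nat.find hex : ℕ) := by exact_mod_cast h2
    omega
  intro Ψ hΨ c' m hm
  refine hn.trans ?_
  have hm0 : 0 ≤ m := by
    have := hm _ h.mem_left
    have : (c' : ℝ) ≤ c' + m := this.1.trans this.2
    have : (0 : ℝ) ≤ m := by linarith
    exact_mod_cast this
  have := Nat.find_min' hex (m := m.toNat) ⟨Φ.trans Ψ, by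
    rw [AffineEquiv.coe_trans, image_comp, hΦ, hΨ], c', fun p hp => by
      have := hm _ (mem_image_of_mem Φ hp)
      have h2 : ((m.toNat : ℕ) : ℝ) = (m : ℝ) := by
        rw [← Int.cast_natCast (R := ℝ), Int.toNat_of_nonneg hm0]
      rw [h2]
      exact this⟩
  omega

/-- If the last column but one has no interior lattice point, the polygon lies in a unimodular
cone with apex at its right end. -/
theorem Strip.subset_cone {P : Set (ℝ × ℝ)} {l r : ℤ} {f g : ℝ → ℝ} (h : Strip P l r f g)
    (hi : (interior P ∩ lattice).Nonempty)
    (hno : ∀ y : ℤ, (((r - 1 : ℤ) : ℝ), (y : ℝ)) ∉ interior P) :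
    ∃ v c : ℤ, f r = v ∧ ∀ p ∈ P, v + (r - p.1) * c ≤ p.2 ∧ p.2 ≤ v + (r - p.1) * (c + 1) := by
  obtain ⟨_, hp0, x₀, y₀, rfl⟩ := hi
  have hne : (interior P).Nonempty := ⟨_, hp0⟩
  rw [h.interior_eq] at hp0
  obtain ⟨⟨hlx, hxr⟩, hgy, hyf⟩ := hp0
  simp only at hlx hxr hgy hyf
  have hlx' : l < x₀ := by exact_mod_cast hlx
  have hxr' : x₀ < r := by exact_mod_cast hxr
  have hx2 : x₀ ≤ r - 2 := by
    by_contra hcon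
    obtain rfl : x₀ = r - 1 := by omega
    refine hno y₀ ?_
    rw [h.interior_eq]
    exact ⟨⟨hlx, hxr⟩, hgy, hyf⟩
  have hx2R : (x₀ : ℝ) ≤ r - 2 := by exact_mod_cast hx2
  have hlR : (l : ℝ) < ((r - 1 : ℤ) : ℝ) := by exact_mod_cast (by omega : l < r - 1)
  have hrR : ((r - 1 : ℤ) : ℝ) < r := by exact_mod_cast (by omega : r - 1 < r)
  -- Without interior lattice points, the column at `r - 1` fits into the window `[k, k + 1]`.
  obtain ⟨k, hk⟩ : ∃ k : ℤ, k = ⌊g ((r - 1 : ℤ) : ℝ)⌋ := ⟨_, rfl⟩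
  have hkg : (k : ℝ) ≤ g ((r - 1 : ℤ) : ℝ) := hk ▸ Int.floor_le _
  have hfk : f ((r - 1 : ℤ) : ℝ) ≤ k + 1 := by
    by_contra! hcon
    refine hno (k + 1) ?_
    rw [h.interior_eq]
    refine ⟨⟨hlR, hrR⟩, ?_, ?_⟩
    · rw [hk]; push_cast; exact Int.lt_floor_add_one _
    · push_cast at hcon ⊢; exact hcon
  obtain ⟨A, hA⟩ := h.roof.right
  obtain ⟨B', hB'⟩ := h.floor.right
  obtain ⟨B, hB⟩ : ∃ B : ℤ, g r = B := ⟨-B', by push_cast; linarith⟩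
  have hlr : (l : ℝ) ≤ r := (hlR.trans hrR).le
  have hrI : (r : ℝ) ∈ Icc (l : ℝ) r := ⟨hlr, le_rfl⟩
  have hfx : ∀ x ∈ Icc (l : ℝ) ((r - 1 : ℤ) : ℝ), f x ≤ A + (r - x) * (k + 1 - A) := by
    intro x hx
    have := concave_chord_le h.roof.concave (show x ∈ Icc (l : ℝ) r from ⟨hx.1, hx.2.trans hrR.le⟩)
      hrI (hx.2.trans_lt hrR) ⟨hx.2, hrR.le⟩
    rw [hA] at this
    have e := mul_le_mul_of_nonneg_left hfk (show 0 ≤ (r : ℝ) - x by linarith [hx.2])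
    push_cast at this e
    linarith
  have hgx : ∀ x ∈ Icc (l : ℝ) ((r - 1 : ℤ) : ℝ), B + (r - x) * (k - B) ≤ g x := by
    intro x hx
    have := concave_chord_le h.floor.concave
      (show x ∈ Icc (l : ℝ) r from ⟨hx.1, hx.2.trans hrR.le⟩)
      hrI (hx.2.trans_lt hrR) ⟨hx.2, hrR.le⟩
    simp only [hB] at this
    have e := mul_le_mul_of_nonneg_left hkg (show 0 ≤ (r : ℝ) - x by linarith [hx.2])
    push_cast at this e
    linarith
  have hBA : B ≤ A := by
    have := h.g_le r hrI
    rw [hA, hB] at this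
    exact_mod_cast this
  -- If the right edge had length `A - B ≥ 1`, the lines from its ends through the window would
  -- confine the column `x₀`, at distance at least 2, to an open interval with integral ends and
  -- length at most 1. It could not contain `y₀`.
  have hAB : A = B := by
    by_contra hcon
    have hx₀I : (x₀ : ℝ) ∈ Icc (l : ℝ) ((r - 1 : ℤ) : ℝ) :=
      ⟨hlx.le, by push_cast; linarith⟩
    have h1 : y₀ < A + (r - x₀) * (k + 1 - A) := by
      have := hyf.trans_le (hfx x₀ hx₀I)
      exact_mod_cast this
    have h2 : B + (r - x₀) * (k - B) < y₀ := by
      have := (hgx x₀ hx₀I).trans_lt hgy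
      exact_mod_cast this
    have h3 : 0 ≤ (r - x₀ - 2) * (A - B - 1) := mul_nonneg (by omega) (by omega)
    have h4 : B + 1 ≤ A := by omega
    nlinarith
  subst hAB
  refine ⟨A, k - A, hA, fun p hp => ?_⟩
  obtain ⟨hp1, hp2⟩ := (h.mem_iff p).1 hp
  rcases le_or_gt p.1 ((r - 1 : ℤ) : ℝ) with hpr | hpr
  · have h1 := hfx p.1 ⟨hp1.1, hpr⟩
    have h2 := hgx p.1 ⟨hp1.1, hpr⟩
    push_cast
    exact ⟨h2.trans hp2.1, hp2.2.trans (h1.trans (by linarith))⟩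
  -- Breakpoints are integral, so roof and floor are affine on `[r - 1, r]` and the bounds at `r -
  -- 1` carry over.
  · obtain ⟨m, n, -, hm, hn, hnr, -, c, s, hcs⟩ := h.roof.node (r - 1) (by omega) (by omega)
    obtain ⟨m', n', -, hm', hn', hnr', -, c', s', hcs'⟩ :=
      h.floor.node (r - 1) (by omega) (by omega)
    obtain rfl : n = r := by omega
    obtain rfl : n' = n := by omega
    have hmR : (m : ℝ) ≤ ((n' - 1 : ℤ) : ℝ) := by exact_mod_cast hm
    have hmR' : (m' : ℝ) ≤ ((n' - 1 : ℤ) : ℝ) := by exact_mod_cast hm'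
    have a1 := hcs p.1 ⟨hmR.trans hpr.le, hp1.2⟩
    have a2 := hcs n' ⟨hmR.trans hrR.le, le_rfl⟩
    have a3 := hcs _ ⟨hmR, hrR.le⟩
    have b1 := hcs' p.1 ⟨hmR'.trans hpr.le, hp1.2⟩
    have b2 := hcs' n' ⟨hmR'.trans hrR.le, le_rfl⟩
    have b3 := hcs' _ ⟨hmR', hrR.le⟩
    rw [hA] at a2
    rw [hB] at b2
    have hd : 0 ≤ (n' : ℝ) - p.1 := by linarith [hp1.2]
    have e1 : f p.1 = A + (n' - p.1) * (f ((n' - 1 : ℤ) : ℝ) - A) := by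
      rw [a1, a3, a2]; push_cast; ring
    have e2 : g p.1 = A + (n' - p.1) * (g ((n' - 1 : ℤ) : ℝ) - A) := by
      have : -g p.1 = -A + (n' - p.1) * (-g ((n' - 1 : ℤ) : ℝ) + A) := by
        rw [b1, b3, ← neg_neg (A : ℝ), b2]; push_cast; ring
      linarith
    have k1 := mul_le_mul_of_nonneg_left hfk hd
    have k2 := mul_le_mul_of_nonneg_left hkg hd
    push_cast
    constructor
    · linarith [hp2.1]
    · linarith [hp2.2]

/-- The cone and the left vertical line bound a copy of `(r - l)Δ` containing P. `Ψ` and `Ξ` measure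
lattice distance from the two sides of the cone; minimal width gives a point of P at distance at
least `r - l` from each, which must be the opposite vertex. The third vertex is the apex. -/
theorem LatticeEquivalent.triangle_of_cone {P : Set (ℝ × ℝ)} {l r v c : ℤ} {f g : ℝ → ℝ}
    (h : Strip P l r f g) (hlr : l < r) (hP : IsConvexLatticePolygon P)
    (hmin : MinWidth P (r - l)) (hv : f r = v)
    (hcone : ∀ p ∈ P, v + (r - p.1) * c ≤ p.2 ∧ p.2 ≤ v + (r - p.1) * (c + 1)) :
    LatticeEquivalent P (triangle ((r - l : ℤ) : ℝ)) := by
  obtain ⟨Φ, hΦ, hΦv⟩ := exists_lattice_automorphism 1 0 c 1 1 (-l) (-v - r * c) (by ring) (by ring)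
  obtain ⟨Ψ, hΨ, hΨv⟩ := exists_lattice_automorphism c 1 1 0 (-1) (-v - r * c) 0 (by ring) (by ring)
  obtain ⟨Ξ, hΞ, hΞv⟩ := exists_lattice_automorphism (-(c + 1)) (-1) 1 0 1 (r + v + r * c) 0
    (by ring) (by ring)
  have hWpos : (0 : ℝ) < ((r - l : ℤ) : ℝ) := by exact_mod_cast (by omega : 0 < r - l)
  have hPl : ∀ p ∈ P, (l : ℝ) ≤ p.1 := fun p hp => ((h.mem_iff p).1 hp).1.1
  refine ⟨Φ, hΦ, Subset.antisymm ?_ ?_⟩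
  · rintro _ ⟨p, hp, rfl⟩
    obtain ⟨h1, h2⟩ := hcone p hp
    have h3 := hPl p hp
    rw [mem_triangle hWpos, hΦv]
    push_cast
    exact ⟨by linarith, by linarith, by linarith⟩
  · have hconv : Convex ℝ (Φ '' P) := (hP.image hΦ).convex
    refine convexHull_min ?_ hconv
    rintro p (rfl | rfl | rfl)
    · obtain ⟨q, hq, hqW⟩ := hmin.exists_far hP hΞ (c := 0) (fun p hp => by
        rw [hΞv]
        have := (hcone p hp).2
        push_cast
        linarith)
      obtain ⟨h1, h2⟩ := hcone q hq
      have h3 := hPl q hq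
      refine ⟨q, hq, ?_⟩
      rw [hΞv] at hqW
      rw [hΦv]
      push_cast at hqW ⊢
      ext <;> simp only <;> linarith
    · refine ⟨_, h.mem_right, ?_⟩
      rw [hΦv, hv]
      push_cast
      ext <;> simp only <;> ring
    · obtain ⟨q, hq, hqW⟩ := hmin.exists_far hP hΨ (c := 0) (fun p hp => by
        rw [hΨv]
        have := (hcone p hp).1
        push_cast
        linarith)
      obtain ⟨h1, h2⟩ := hcone q hq
      have h3 := hPl q hq
      refine ⟨q, hq, ?_⟩
      rw [hΨv] at hqW
      rw [hΦv]
      push_cast at hqW ⊢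
      ext <;> simp only <;> linarith

theorem triangle_or_right_column {P : Set (ℝ × ℝ)} {l r : ℤ} {f g : ℝ → ℝ}
    (h : Strip P l r f g) (hP : IsConvexLatticePolygon P) (hmin : MinWidth P (r - l))
    (hi : (interior P ∩ lattice).Nonempty) :
    LatticeEquivalent P (triangle ((r - l : ℤ) : ℝ)) ∨
      ∃ y : ℤ, (((r - 1 : ℤ) : ℝ), (y : ℝ)) ∈ interior P := by
  by_contra! hcon
  obtain ⟨v, c, hv, hcone⟩ := h.subset_cone hi hcon.2
  exact hcon.1 (LatticeEquivalent.triangle_of_cone h (h.lt_of_interior hP.2).1 hP hmin hv hcone)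

/-- Reflection in the vertical axis reduces this to the right column. -/
theorem triangle_or_left_column {P : Set (ℝ × ℝ)} {l r : ℤ} {f g : ℝ → ℝ}
    (h : Strip P l r f g) (hP : IsConvexLatticePolygon P) (hmin : MinWidth P (r - l))
    (hi : (interior P ∩ lattice).Nonempty) :
    LatticeEquivalent P (triangle ((r - l : ℤ) : ℝ)) ∨
      ∃ y : ℤ, (((l + 1 : ℤ) : ℝ), (y : ℝ)) ∈ interior P := by
  obtain ⟨Φ, hΦ, hΦv⟩ := exists_lattice_automorphism (-1) 0 0 1 (-1) 0 0 (by ring) (by ring)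
  have hQ := hP.image hΦ
  obtain ⟨l', r', f', g', h'⟩ := hQ.exists_strip
  have hl' : l' = -r := by
    apply le_antisymm
    · have := ((h'.mem_iff _).1 (mem_image_of_mem Φ h.mem_right)).1.1
      rw [hΦv] at this
      push_cast at this
      have : (l' : ℝ) ≤ -r := by linarith
      exact_mod_cast this
    · obtain ⟨p, hp, hpl⟩ := h'.mem_left
      have := ((h.mem_iff p).1 hp).1.2
      rw [hΦv] at hpl
      have h2 := congrArg Prod.fst hpl
      push_cast at h2
      have : (-r : ℝ) ≤ l' := by linarith
      exact_mod_cast this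
  have hr' : r' = -l := by
    apply le_antisymm
    · obtain ⟨p, hp, hpl⟩ := h'.mem_right
      have := ((h.mem_iff p).1 hp).1.1
      rw [hΦv] at hpl
      have h2 := congrArg Prod.fst hpl
      push_cast at h2
      have : (r' : ℝ) ≤ -l := by linarith
      exact_mod_cast this
    · have := ((h'.mem_iff _).1 (mem_image_of_mem Φ h.mem_left)).1.2
      rw [hΦv] at this
      push_cast at this
      have : (-l : ℝ) ≤ r' := by linarith
      exact_mod_cast this
  have hW : r' - l' = r - l := by omega
  have hmin' : MinWidth (Φ '' P) (r' - l') := hW ▸ hmin.image hΦ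
  have hi' : (interior (Φ '' P) ∩ lattice).Nonempty := by
    rw [← image_interior_lattice hΦ]
    exact hi.image _
  rcases triangle_or_right_column h' hQ hmin' hi' with h1 | ⟨y, hy⟩
  · left
    rw [hW] at h1
    exact LatticeEquivalent.trans ⟨Φ, hΦ, rfl⟩ h1
  · right
    rw [← image_interior] at hy
    obtain ⟨p, hp, hpy⟩ := hy
    rw [hΦv] at hpy
    have e1 := congrArg Prod.fst hpy
    have e2 := congrArg Prod.snd hpy
    push_cast [hr'] at e1 e2
    refine ⟨y, ?_⟩
    have : p = (((l + 1 : ℤ) : ℝ), (y : ℝ)) := by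
      push_cast
      ext <;> simp only <;> linarith
    rwa [← this]

theorem exists_layer {P : Set (ℝ × ℝ)} {l r : ℤ} {f g : ℝ → ℝ}
    (h : Strip P l r f g) (hP : IsConvexLatticePolygon P)
    (hL : ∃ y : ℤ, (((l + 1 : ℤ) : ℝ), (y : ℝ)) ∈ interior P)
    (hR : ∃ y : ℤ, (((r - 1 : ℤ) : ℝ), (y : ℝ)) ∈ interior P) :
    ∃ φ γ : ℝ → ℝ, Layer P l r f g φ γ := by
  have hfin : (interior P ∩ lattice).Finite :=
    h.finite_lattice.subset (inter_subset_inter_left _ interior_subset)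
  have hcoe : ((hfin.toFinset : Finset (ℝ × ℝ)) : Set (ℝ × ℝ)) = interior P ∩ lattice :=
    hfin.coe_toFinset
  obtain ⟨φ, γ, hs⟩ := Strip.exists_of_extent (V := hfin.toFinset) (l := l + 1) (r := r - 1)
    (by rw [hcoe]; exact inter_subset_right)
    (by
      intro v hv
      rw [Set.Finite.mem_toFinset, h.interior_lattice_eq] at hv
      obtain ⟨k, y, hk, -, -, rfl⟩ := hv
      rw [Finset.mem_Ioo] at hk
      exact ⟨Int.cast_le.2 (by omega), Int.cast_le.2 (by omega)⟩)
    (by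
      obtain ⟨y, hy⟩ := hL
      exact ⟨_, (Set.Finite.mem_toFinset _).2 ⟨hy, _, _, rfl⟩, rfl⟩)
    (by
      obtain ⟨y, hy⟩ := hR
      exact ⟨_, (Set.Finite.mem_toFinset _).2 ⟨hy, _, _, rfl⟩, rfl⟩)
  rw [hcoe] at hs
  exact ⟨φ, γ, h, hP.isClosed, hs⟩

/-- Up to lattice equivalence, a polygon with interior lattice points is a multiple of the
standard triangle, or its peel reaches all columns but the outer ones. -/
theorem triangle_or_layer {P : Set (ℝ × ℝ)} (hP : IsConvexLatticePolygon P)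
    (hi : (interior P ∩ lattice).Nonempty) :
    (∃ W : ℤ, 1 ≤ W ∧ LatticeEquivalent P (triangle W)) ∨
      ∃ (Q : Set (ℝ × ℝ)) (l r : ℤ) (f g φ γ : ℝ → ℝ), LatticeEquivalent P Q ∧
        IsConvexLatticePolygon Q ∧ Layer Q l r f g φ γ := by
  obtain ⟨Q, hPQ, hQ, l, r, f, g, h, hmin⟩ := hP.exists_minWidth
  have hi' : (interior Q ∩ lattice).Nonempty := by
    obtain ⟨Φ, hΦ, rfl⟩ := hPQ
    rw [← image_interior_lattice hΦ]
    exact hi.image _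
  have hlr := (h.lt_of_interior hQ.2).1
  rcases triangle_or_right_column h hQ hmin hi' with h1 | hR
  · exact Or.inl ⟨r - l, by omega, hPQ.trans h1⟩
  rcases triangle_or_left_column h hQ hmin hi' with h1 | hL
  · exact Or.inl ⟨r - l, by omega, hPQ.trans h1⟩
  obtain ⟨φ, γ, hlay⟩ := exists_layer h hQ hL hR
  exact Or.inr ⟨Q, l, r, f, g, φ, γ, hPQ, hQ, hlay⟩

/-! ### Affine roofs and multiples of the standard triangle -/

theorem Roof.affine {c s : ℝ} {l r : ℤ} (hl : ∃ a : ℤ, c + s * l = a)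
    (hr : ∃ a : ℤ, c + s * r = a) : Roof (fun x => c + s * x) l r where
  concave := by
    refine ⟨convex_Icc _ _, fun x _ y _ a b _ _ hab => le_of_eq ?_⟩
    simp only [smul_eq_mul]
    linear_combination c * hab
  node := fun k h1 h2 => by
    obtain ⟨a, ha⟩ := hl
    obtain ⟨b, hb⟩ := hr
    exact ⟨l, r, le_rfl, h1, h2, le_rfl, ⟨a, b, ha, hb⟩, c, s, fun x _ => rfl⟩
  left := hl
  right := hr

theorem triangle_strip {k : ℤ} (hk : 1 ≤ k) :
    Strip (triangle k) 0 k (fun x => k + (-1) * x) (fun _ => 0) where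
  le := by omega
  roof := Roof.affine ⟨k, by push_cast; ring⟩ ⟨0, by push_cast; ring⟩
  floor := by simpa using Roof.affine (c := 0) (s := 0) (l := 0) (r := k) ⟨0, by simp⟩ ⟨0, by simp⟩
  g_le := fun x hx => by linarith [hx.2]
  mem_iff := fun p => by
    rw [mem_triangle (by exact_mod_cast (by omega : 0 < k))]
    simp only [mem_Icc, Int.cast_zero]
    constructor
    · rintro ⟨h1, h2, h3⟩
      exact ⟨⟨h1, by linarith⟩, h2, by linarith⟩
    · rintro ⟨⟨h1, h2⟩, h3, h4⟩
      exact ⟨h1, h3, by linarith⟩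

theorem triangle_polygon {k : ℤ} (hk : 1 ≤ k) : IsConvexLatticePolygon (triangle k) := by
  classical
  refine ⟨⟨{(0, 0), ((k : ℝ), 0), (0, (k : ℝ))}, ?_, ?_⟩, ((1 / 3 : ℝ), (1 / 3 : ℝ)), ?_⟩
  · intro p hp
    simp only [Finset.coe_insert, Finset.coe_singleton, mem_insert_iff, mem_singleton_iff] at hp
    rcases hp with rfl | rfl | rfl
    · exact ⟨0, 0, by simp⟩
    · exact ⟨k, 0, by simp⟩
    · exact ⟨0, k, by simp⟩
  · simp [triangle]
  · rw [(triangle_strip hk).interior_eq]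
    have : (1 : ℝ) ≤ k := by exact_mod_cast hk
    refine ⟨⟨by norm_num, by simp only; linarith⟩, by norm_num, by simp only; linarith⟩

theorem boundaryPoints_triangle {k : ℤ} (hk : 1 ≤ k) :
    (boundaryPoints (triangle k) : ℤ) = 3 * k := by
  rw [(triangle_strip hk).boundaryPoints_eq (triangle_polygon hk).isClosed (triangle_polygon hk).2]
  have h : ∀ j ∈ Finset.Ioo 0 k, chi ((k : ℝ) + (-1) * (j : ℤ)) + chi 0 = 2 := fun j _ => by
    rw [chi_eq_one ⟨k - j, by push_cast; ring⟩, chi_eq_one ⟨0, by simp⟩]; rfl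
  rw [Finset.sum_congr rfl h]
  simp only [Finset.sum_const, Int.card_Ioo, nsmul_eq_mul]
  simp
  omega

theorem interior_triangle_lattice {k : ℤ} (hk : 1 ≤ k) {x y : ℤ} :
    (((x : ℝ), (y : ℝ)) ∈ interior (triangle k)) ↔ 1 ≤ x ∧ 1 ≤ y ∧ x + y ≤ k - 1 := by
  rw [(triangle_strip hk).interior_eq]
  simp only [mem_ofPred_eq, mem_Ioo, Int.cast_zero]
  constructor
  · rintro ⟨⟨h1, h2⟩, h3, h4⟩
    have h4' : (x : ℝ) + y < k := by linarith
    refine ⟨by exact_mod_cast h1, by exact_mod_cast h3, ?_⟩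
    have : x + y < k := by exact_mod_cast h4'
    omega
  · rintro ⟨h1, h2, h3⟩
    have h1' : (1 : ℝ) ≤ x := by exact_mod_cast h1
    have h2' : (1 : ℝ) ≤ y := by exact_mod_cast h2
    have h3' : (x : ℝ) + y ≤ k - 1 := by exact_mod_cast h3
    exact ⟨⟨by linarith, by linarith⟩, by linarith, by linarith⟩

theorem peel_triangle {k : ℤ} (hk : 4 ≤ k) :
    LatticeEquivalent (peel (triangle k)) (triangle ((k - 3 : ℤ) : ℝ)) := by
  obtain ⟨Φ, hΦ, hΦv⟩ := exists_lattice_automorphism 1 0 0 1 1 (-1) (-1) (by ring) (by ring)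
  refine ⟨Φ, hΦ, Subset.antisymm ?_ ?_⟩
  · rw [image_subset_iff]
    refine convexHull_min ?_ ((convex_convexHull ℝ _).affine_preimage Φ.toAffineMap)
    rintro _ ⟨h, x, y, rfl⟩
    rw [interior_triangle_lattice (by omega)] at h
    change Φ _ ∈ triangle _
    rw [mem_triangle (by exact_mod_cast (by omega : 0 < k - 3)), hΦv]
    have h1 : (1 : ℝ) ≤ x := by exact_mod_cast h.1
    have h2 : (1 : ℝ) ≤ y := by exact_mod_cast h.2.1
    have h3 : (x : ℝ) + y ≤ k - 1 := by exact_mod_cast h.2.2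
    push_cast
    exact ⟨by linarith, by linarith, by linarith⟩
  · refine convexHull_min ?_ ((convex_convexHull ℝ _).affine_image Φ.toAffineMap)
    have key : ∀ x y : ℤ, 1 ≤ x → 1 ≤ y → x + y ≤ k - 1 →
        ((x : ℝ) - 1, (y : ℝ) - 1) ∈ Φ '' peel (triangle k) := by
      intro x y h1 h2 h3
      refine ⟨((x : ℝ), (y : ℝ)), subset_convexHull ℝ _
        ⟨(interior_triangle_lattice (by omega)).2 ⟨h1, h2, h3⟩, x, y, rfl⟩, ?_⟩
      rw [hΦv]
      push_cast
      ext <;> simp only <;> ring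
    rintro p (rfl | rfl | rfl)
    · simpa using key 1 1 le_rfl le_rfl (by omega)
    · convert key (k - 2) 1 (by omega) le_rfl (by omega) using 2 <;> push_cast <;> ring
    · convert key 1 (k - 2) le_rfl (by omega) (by omega) using 2 <;> push_cast <;> ring

theorem four_le_of_peel_triangle {k : ℤ} (hk : 1 ≤ k)
    (hne : (interior (peel (triangle k))).Nonempty) : 4 ≤ k := by
  by_contra hcon
  have hsub : peel (triangle k) ⊆ {((1 : ℝ), (1 : ℝ))} := by
    refine convexHull_min ?_ (convex_singleton _)
    rintro _ ⟨h, x, y, rfl⟩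
    rw [interior_triangle_lattice hk] at h
    obtain ⟨h1, h2, h3⟩ := h
    obtain rfl : x = 1 := by omega
    obtain rfl : y = 1 := by omega
    simp
  have := hne.mono (interior_mono hsub)
  simp at this

theorem interiorPoints_triangle_three : interiorPoints (triangle ((3 : ℤ) : ℝ)) = 1 := by
  have hk : (1 : ℤ) ≤ 3 := by norm_num
  have h : interior (triangle ((3 : ℤ) : ℝ)) ∩ lattice = {((1 : ℝ), (1 : ℝ))} := by
    ext p
    rw [mem_singleton_iff]
    constructor
    · rintro ⟨h, x, y, rfl⟩
      rw [interior_triangle_lattice hk] at h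
      obtain ⟨h1, h2, h3⟩ := h
      obtain rfl : x = 1 := by omega
      obtain rfl : y = 1 := by omega
      simp
    · rintro rfl
      have := (interior_triangle_lattice hk (x := 1) (y := 1)).2 (by norm_num)
      push_cast at this ⊢
      exact ⟨this, 1, 1, by simp⟩
  rw [interiorPoints, h, ncard_singleton]

/-! ### The inequalities for a polygon and its peel -/

theorem IsConvexLatticePolygon.pick {P : Set (ℝ × ℝ)} (hP : IsConvexLatticePolygon P) :
    area P = interiorPoints P + (boundaryPoints P : ℝ) / 2 - 1 := by
  obtain ⟨l, r, f, g, h⟩ := hP.exists_strip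
  exact h.pick hP.isClosed hP.2

theorem chi_nonneg (x : ℝ) : 0 ≤ chi x := by
  have := Int.ceil_le_floor_add_one x
  unfold chi
  omega

/-- Without inner lattice points the roof is a single segment; only its midpoint is needed. -/
theorem Roof.eq_of_chi_eq_zero {f : ℝ → ℝ} {l r : ℤ} (h : Roof f l r) (hlr : l < r)
    (h0 : ∀ k ∈ Finset.Ioo l r, chi (f k) = 0) :
    f (((l : ℝ) + r) / 2) = (f l + f r) / 2 := by
  obtain ⟨m, n, h1, h2, h3, h4, ⟨a, b, ha, hb⟩, c, s, hcs⟩ := h.node l le_rfl hlr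
  obtain rfl : m = l := le_antisymm h2 h1
  have hn : n = r := by
    by_contra hcon
    have e := h0 n (Finset.mem_Ioo.2 ⟨h3, by omega⟩)
    rw [chi_eq_one ⟨b, hb⟩] at e
    exact one_ne_zero e
  subst hn
  have hmn : (m : ℝ) ≤ n := by exact_mod_cast hlr.le
  rw [hcs _ ⟨by linarith, by linarith⟩, hcs m ⟨le_rfl, hmn⟩, hcs n ⟨hmn, le_rfl⟩]
  ring

/-- Each outer column has a boundary point. With no more than these two, roof and floor are both the
segment joining them, contradicting `g < f` at the midpoint. -/
theorem IsConvexLatticePolygon.three_le {P : Set (ℝ × ℝ)} (hP : IsConvexLatticePolygon P) :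
    3 ≤ boundaryPoints P := by
  obtain ⟨l, r, f, g, h⟩ := hP.exists_strip
  obtain ⟨hlr, hlt⟩ := h.lt_of_interior hP.2
  by_contra hcon
  have hb := h.boundaryPoints_eq hP.isClosed hP.2
  have hlr' : (l : ℝ) < r := by exact_mod_cast hlr
  obtain ⟨a, ha⟩ := h.roof.left
  obtain ⟨b, hb'⟩ := h.roof.right
  obtain ⟨c, hc⟩ := h.floor.left
  obtain ⟨d, hd⟩ := h.floor.right
  have hc' : g l = ((-c : ℤ) : ℝ) := by push_cast; linarith
  have hd' : g r = ((-d : ℤ) : ℝ) := by push_cast; linarith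
  have h1 := h.g_le l ⟨le_rfl, hlr'.le⟩
  have h2 := h.g_le r ⟨hlr'.le, le_rfl⟩
  have hs : ∀ k ∈ Finset.Ioo l r, 0 ≤ chi (f k) + chi (g k) := fun k _ =>
    add_nonneg (chi_nonneg _) (chi_nonneg _)
  have hs0 := Finset.sum_nonneg hs
  rw [ha, hc'] at h1
  rw [hb', hd'] at h2
  rw [ha, hb', hc', hd'] at hb
  simp only [Int.floor_intCast, Int.ceil_intCast] at hb
  have h1' : -c ≤ a := by exact_mod_cast h1
  have h2' : -d ≤ b := by exact_mod_cast h2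
  have hz : ∑ k ∈ Finset.Ioo l r, (chi (f k) + chi (g k)) = 0 := by omega
  have hz' := (Finset.sum_eq_zero_iff_of_nonneg hs).1 hz
  have e1 := h.roof.eq_of_chi_eq_zero hlr fun k hk => by
    linarith [hz' k hk, chi_nonneg (f k), chi_nonneg (g k)]
  have e2 := h.floor.eq_of_chi_eq_zero hlr fun k hk => by
    rw [chi_neg]
    linarith [hz' k hk, chi_nonneg (f k), chi_nonneg (g k)]
  have hlt' := hlt (((l : ℝ) + r) / 2) ⟨by linarith, by linarith⟩
  have hac : a = -c := by omega
  have hbd : b = -d := by omega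
  rw [ha, hb', hac, hbd] at e1
  rw [hc, hd] at e2
  push_cast at e1
  linarith

theorem IsConvexLatticePolygon.finite_lattice {P : Set (ℝ × ℝ)} (hP : IsConvexLatticePolygon P) :
    (P ∩ lattice).Finite := by
  obtain ⟨l, r, f, g, h⟩ := hP.exists_strip
  exact h.finite_lattice

theorem IsConvexLatticePolygon.finite_interior {P : Set (ℝ × ℝ)} (hP : IsConvexLatticePolygon P) :
    (interior P ∩ lattice).Finite :=
  hP.finite_lattice.subset (inter_subset_inter_left _ interior_subset)

theorem IsConvexLatticePolygon.peel {P : Set (ℝ × ℝ)} (hP : IsConvexLatticePolygon P)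
    (hne : (interior (peel P)).Nonempty) : IsConvexLatticePolygon (LatticePolygon.peel P) :=
  ⟨⟨hP.finite_interior.toFinset, by simp, by rw [Set.Finite.coe_toFinset]; rfl⟩, hne⟩

theorem interior_lattice_nonempty_of_peel {P : Set (ℝ × ℝ)}
    (hne : (interior (peel P)).Nonempty) : (interior P ∩ lattice).Nonempty := by
  by_contra h
  rw [not_nonempty_iff_eq_empty] at h
  rw [LatticePolygon.peel, h] at hne
  simp at hne

theorem IsConvexLatticePolygon.interiorPoints_eq_peel {P : Set (ℝ × ℝ)}
    (hP : IsConvexLatticePolygon P) (hne : (interior (LatticePolygon.peel P)).Nonempty) :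
    interiorPoints P =
      boundaryPoints (LatticePolygon.peel P) + interiorPoints (LatticePolygon.peel P) := by
  have hQ := hP.peel hne
  obtain ⟨l, r, f, g, h⟩ := hQ.exists_strip
  rw [h.boundaryPoints_add hQ.isClosed, peel_inter_lattice hP.convex]
  rfl

/-- Peeling removes at most nine boundary points. -/
theorem IsConvexLatticePolygon.boundaryPoints_le_peel {P : Set (ℝ × ℝ)}
    (hP : IsConvexLatticePolygon P) (hne : (interior (LatticePolygon.peel P)).Nonempty) :
    boundaryPoints P ≤ boundaryPoints (LatticePolygon.peel P) + 9 := by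
  rcases triangle_or_layer hP (interior_lattice_nonempty_of_peel hne) with
    ⟨W, hW, he⟩ | ⟨Q, l, r, f, g, φ, γ, he, hQ, h⟩
  · have h4 := four_le_of_peel_triangle hW (he.peel.interior_nonempty hne)
    have h1 := boundaryPoints_triangle hW
    have h2 := boundaryPoints_triangle (k := W - 3) (by omega)
    rw [he.boundaryPoints_eq, he.peel.boundaryPoints_eq, (peel_triangle h4).boundaryPoints_eq]
    omega
  · have := h.boundaryPoints_le_peel hQ.2 (he.peel.interior_nonempty hne)
    rw [he.boundaryPoints_eq, he.peel.boundaryPoints_eq]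
    omega

/-- Scott's inequality. -/
theorem IsConvexLatticePolygon.scott {P : Set (ℝ × ℝ)} (hP : IsConvexLatticePolygon P)
    (hi : (interior P ∩ lattice).Nonempty) :
    boundaryPoints P ≤ 2 * interiorPoints P + 6 ∨
      (boundaryPoints P = 9 ∧ interiorPoints P = 1) := by
  rcases triangle_or_layer hP hi with ⟨W, hW, he⟩ | ⟨Q, l, r, f, g, φ, γ, he, hQ, h⟩
  · have hT := triangle_polygon hW
    have h1 := boundaryPoints_triangle hW
    have h3 : 3 ≤ W := by
      obtain ⟨Φ, hΦ, hΦP⟩ := he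
      have := hi.image Φ
      rw [image_interior_lattice hΦ, hΦP] at this
      obtain ⟨_, hp, x, y, rfl⟩ := this
      rw [interior_triangle_lattice hW] at hp
      omega
    rw [he.boundaryPoints_eq, he.interiorPoints_eq]
    rcases h3.eq_or_lt with rfl | h4
    · right
      exact ⟨by omega, interiorPoints_triangle_three⟩
    · left
      have hpe := peel_triangle (k := W) (by omega)
      have hS : LatticeEquivalent (triangle ((W - 3 : ℤ) : ℝ))
          (LatticePolygon.peel (triangle W)) := by
        obtain ⟨Φ, hΦ, hΦP⟩ := hpe
        refine ⟨Φ.symm, ?_, ?_⟩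
        · nth_rewrite 1 [← hΦ]
          rw [← image_comp]
          simp
        · rw [← hΦP, ← image_comp]
          simp
      -- Here b = 3W and i ≥ 3(W - 3), so W ≥ 4 already yields b ≤ 2i + 6.
      have hne := hS.interior_nonempty (triangle_polygon (k := W - 3) (by omega)).2
      have h5 := hT.interiorPoints_eq_peel hne
      have h6 := boundaryPoints_triangle (k := W - 3) (by omega)
      rw [hpe.boundaryPoints_eq] at h5
      omega
  · left
    rw [he.boundaryPoints_eq, he.interiorPoints_eq]
    exact h.scott hQ.2

/-! ### The level -/

theorem peelCount_eq_zero {P : Set (ℝ × ℝ)} (h : interior P ∩ lattice = ∅) : peelCount P = 0 :=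
  Nat.sInf_eq_zero.2 (Or.inl h)

/-- The hypothesis `hex` rules out the default value `sInf ∅ = 0`. -/
theorem peelCount_eq_succ {P : Set (ℝ × ℝ)} (h : (interior P ∩ lattice).Nonempty)
    (hex : ∃ k, interior (peel^[k] (peel P)) ∩ lattice = ∅) :
    peelCount P = peelCount (peel P) + 1 := by
  have h1 : interior (peel^[peelCount (peel P)] (peel P)) ∩ lattice = ∅ := Nat.sInf_mem hex
  have h2 : interior (peel^[peelCount P] P) ∩ lattice = ∅ :=
    Nat.sInf_mem (s := {k : ℕ | interior (peel^[k] P) ∩ lattice = ∅}) ⟨_ + 1, h1⟩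
  apply le_antisymm
  · exact Nat.sInf_le h1
  · rcases hn : peelCount P with _ | n
    · rw [hn] at h2
      exact absurd h2 h.ne_empty
    · rw [hn] at h2
      exact Nat.succ_le_succ (Nat.sInf_le h2)

theorem level_eq_add_one {P : Set (ℝ × ℝ)} (h : (interior P ∩ lattice).Nonempty)
    (hex : ∃ k, interior (peel^[k] (peel P)) ∩ lattice = ∅) :
    level P = level (peel P) + 1 := by
  have h1 := peelCount_eq_succ h hex
  have h2 : nucleus P = nucleus (peel P) := by
    rw [nucleus, h1]
    rfl
  unfold level
  rw [h1, h2]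
  push_cast
  split_ifs <;> ring

theorem level_nonneg (P : Set (ℝ × ℝ)) : 0 ≤ level P := by
  unfold level
  split_ifs <;> positivity

/-- Termination of peeling is proved in the same induction, since `level_eq_add_one` needs it. -/
theorem IsConvexLatticePolygon.level_inequality_aux (n : ℕ) : ∀ P : Set (ℝ × ℝ),
    IsConvexLatticePolygon P → interiorPoints P ≤ n →
    (∃ k, interior (LatticePolygon.peel^[k] P) ∩ lattice = ∅) ∧
    (2 * level P - 1) * (boundaryPoints P : ℝ) ≤
      2 * (interiorPoints P : ℝ) + 9 * level P ^ 2 - 2 := by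
  induction n using Nat.strong_induction_on with
  | _ n ih =>
    intro P hP hn
    have hb : (3 : ℝ) ≤ boundaryPoints P := by exact_mod_cast hP.three_le
    by_cases h0 : interior P ∩ lattice = ∅
    · refine ⟨⟨0, h0⟩, ?_⟩
      have hi : interiorPoints P = 0 := by rw [interiorPoints, h0, ncard_empty]
      have hc := peelCount_eq_zero h0
      have hnuc : nucleus P = P := by rw [nucleus, hc]; rfl
      have hb' : (boundaryPoints P : ℝ) = 6 ∨ ¬ LatticeEquivalent P (triangle 2) := by
        by_cases h2 : LatticeEquivalent P (triangle 2)
        · left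
          have := boundaryPoints_triangle (k := 2) (by norm_num)
          push_cast at this
          rw [h2.boundaryPoints_eq]
          exact_mod_cast this
        · exact Or.inr h2
      unfold level
      rw [hnuc, hc, hi]
      push_cast
      rw [if_neg hP.2.ne_empty]
      -- Level 1/3 requires b ≥ 3, level 2/3 is equality for b = 6, and level 1/2 makes the left
      -- side zero.
      split_ifs with h1 h2
      · linarith
      · rcases hb' with h | h
        · rw [h]; norm_num
        · exact absurd h2 h
      · norm_num
    · have hi := nonempty_iff_ne_empty.2 h0
      by_cases hne : (interior (LatticePolygon.peel P)).Nonempty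
      · have hQ := hP.peel hne
        have hiQ := hP.interiorPoints_eq_peel hne
        have h3 := hQ.three_le
        obtain ⟨hex, hineq⟩ := ih (interiorPoints (LatticePolygon.peel P)) (by omega) _ hQ le_rfl
        obtain ⟨k, hk⟩ := hex
        refine ⟨⟨k + 1, hk⟩, ?_⟩
        rw [level_eq_add_one hi ⟨k, hk⟩]
        have h9 : (boundaryPoints P : ℝ) ≤ boundaryPoints (LatticePolygon.peel P) + 9 := by
          exact_mod_cast hP.boundaryPoints_le_peel hne
        have hiR : (interiorPoints P : ℝ) = boundaryPoints (LatticePolygon.peel P) +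
            interiorPoints (LatticePolygon.peel P) := by exact_mod_cast hiQ
        have hl := level_nonneg (LatticePolygon.peel P)
        -- With ℓ, b', i' for the peel, (2ℓ + 1)(b' + 9) = (2ℓ - 1)b' + 2b' + 9(ℓ + 1)² - 9ℓ²; the
        -- induction hypothesis bounds the first term, and b' + i' = i(P).
        have hm := mul_le_mul_of_nonneg_left h9
          (show 0 ≤ 2 * (level (LatticePolygon.peel P) + 1) - 1 by linarith)
        rw [hiR]
        linarith
      · rw [not_nonempty_iff_eq_empty] at hne
        have h1 : interior (LatticePolygon.peel P) ∩ lattice = ∅ := by rw [hne, empty_inter]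
        refine ⟨⟨1, h1⟩, ?_⟩
        have hc := peelCount_eq_zero h1
        have hl : level P = 1 := by
          rw [level_eq_add_one hi ⟨0, h1⟩, level, nucleus, hc]
          simp [hne]
        rw [hl]
        -- At level 1 the claim is b ≤ 2i + 7, which leaves room for the exception b = 9, i = 1.
        have h7 : boundaryPoints P ≤ 2 * interiorPoints P + 7 := by
          rcases hP.scott hi with h | h <;> omega
        have : (boundaryPoints P : ℝ) ≤ 2 * interiorPoints P + 7 := by exact_mod_cast h7
        linarith

theorem IsConvexLatticePolygon.level_inequality {P : Set (ℝ × ℝ)}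
    (hP : IsConvexLatticePolygon P) : (2 * level P - 1) * (boundaryPoints P : ℝ) ≤
      2 * (interiorPoints P : ℝ) + 9 * level P ^ 2 - 2 :=
  (IsConvexLatticePolygon.level_inequality_aux _ P hP le_rfl).2

/-! ### Explicit polygons -/

/-- A roof over `[0, 2]` through `(0, a)`, `(1, b)`, `(2, d)`. -/
theorem Roof.tent {a b d : ℤ} (h : a + d ≤ 2 * b) :
    Roof (fun x => min (a + (b - a) * x) (2 * b - d + (d - b) * x)) 0 2 := by
  have hR : (a : ℝ) + d ≤ 2 * b := by exact_mod_cast h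
  have v1 : ∀ x : ℝ, x ≤ 1 →
      min ((a : ℝ) + (b - a) * x) (2 * b - d + (d - b) * x) = a + (b - a) * x := fun x hx =>
    min_eq_left (by nlinarith)
  have v2 : ∀ x : ℝ, 1 ≤ x →
      min ((a : ℝ) + (b - a) * x) (2 * b - d + (d - b) * x) = 2 * b - d + (d - b) * x :=
    fun x hx => min_eq_right (by nlinarith)
  have haff : ∀ c s : ℝ, ConcaveOn ℝ (Icc ((0 : ℤ) : ℝ) (2 : ℤ)) fun x => c + s * x := fun c s =>
    ⟨convex_Icc _ _, fun x _ y _ a b _ _ hab => le_of_eq (by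
      simp only [smul_eq_mul]
      linear_combination c * hab)⟩
  have e0 : min ((a : ℝ) + (b - a) * ((0 : ℤ) : ℝ)) (2 * b - d + (d - b) * ((0 : ℤ) : ℝ)) = a := by
    rw [v1 _ (by norm_num)]; simp
  have e1 : min ((a : ℝ) + (b - a) * ((1 : ℤ) : ℝ)) (2 * b - d + (d - b) * ((1 : ℤ) : ℝ)) = b := by
    rw [v1 _ (by norm_num)]; simp
  have e2 : min ((a : ℝ) + (b - a) * ((2 : ℤ) : ℝ)) (2 * b - d + (d - b) * ((2 : ℤ) : ℝ)) = d := by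
    rw [v2 _ (by norm_num)]; push_cast; ring
  refine ⟨(haff _ _).inf (haff _ _), fun k h1 h2 => ?_, ⟨a, e0⟩, ⟨d, e2⟩⟩
  have hk : k = 0 ∨ k = 1 := by omega
  rcases hk with rfl | rfl
  · exact ⟨0, 1, le_rfl, le_rfl, by norm_num, by norm_num, ⟨a, b, e0, e1⟩, a, b - a,
      fun x hx => v1 x (by simpa using hx.2)⟩
  · exact ⟨1, 2, by norm_num, le_rfl, by norm_num, le_rfl, ⟨b, d, e1, e2⟩, 2 * b - d, d - b,
      fun x hx => v2 x (by simpa using hx.1)⟩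

theorem tent_of_le_one {a b d : ℤ} (h : a + d ≤ 2 * b) {x : ℝ} (hx : x ≤ 1) :
    min ((a : ℝ) + (b - a) * x) (2 * b - d + (d - b) * x) = a + (b - a) * x := by
  have hR : (a : ℝ) + d ≤ 2 * b := by exact_mod_cast h
  exact min_eq_left (by nlinarith)

theorem tent_of_one_le {a b d : ℤ} (h : a + d ≤ 2 * b) {x : ℝ} (hx : 1 ≤ x) :
    min ((a : ℝ) + (b - a) * x) (2 * b - d + (d - b) * x) = 2 * b - d + (d - b) * x := by
  have hR : (a : ℝ) + d ≤ 2 * b := by exact_mod_cast h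
  exact min_eq_right (by nlinarith)

/-- A polygon that is a strip by rows has the numbers given by the row counts. -/
theorem realizes_of_rows {S : Set (ℝ × ℝ)} {r b i : ℤ} {f g : ℝ → ℝ} (hfin : S.Finite)
    (hlat : S ⊆ lattice) (hr : 0 < r) (hf : Roof f 0 r) (hg : Roof (fun x => -g x) 0 r)
    (hgf : ∀ x ∈ Icc (0 : ℝ) r, g x ≤ f x) {x₀ : ℝ} (hx₀ : x₀ ∈ Ioo (0 : ℝ) r) (hlt : g x₀ < f x₀)
    (hS : ∀ p ∈ S, p.2 ∈ Icc (0 : ℝ) r ∧ p.1 ∈ Icc (g p.2) (f p.2))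
    (hfS : ∀ x ∈ Icc (0 : ℝ) r, (f x, x) ∈ convexHull ℝ S)
    (hgS : ∀ x ∈ Icc (0 : ℝ) r, (g x, x) ∈ convexHull ℝ S)
    (hb : ∑ k ∈ Finset.Ioo 0 r, (chi (f k) + chi (g k)) + (⌊f 0⌋ - ⌈g 0⌉ + 1) +
      (⌊f r⌋ - ⌈g r⌉ + 1) = b)
    (hi : ∑ k ∈ Finset.Ioo 0 r, (⌈f k⌉ - ⌊g k⌋ - 1) = i) :
    Realizes (convexHull ℝ S) ((i : ℝ) + (b : ℝ) / 2 - 1) b i := by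
  -- Swapping coordinates turns rows into columns.
  obtain ⟨Φ, hΦ, hΦv⟩ := exists_lattice_automorphism 0 1 1 0 (-1) 0 0 (by ring) (by ring)
  have hΦv' : ∀ p, Φ p = (p.2, p.1) := fun p => by rw [hΦv]; simp
  have hK : Strip {p : ℝ × ℝ | p.1 ∈ Icc ((0 : ℤ) : ℝ) r ∧ p.2 ∈ Icc (g p.1) (f p.1)} 0 r f g :=
    ⟨hr.le, hf, hg, by simpa using hgf, fun _ => Iff.rfl⟩
  have hconv : Convex ℝ (Φ '' convexHull ℝ S) :=
    (convex_convexHull ℝ _).affine_image Φ.toAffineMap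
  have himg : Φ '' convexHull ℝ S =
      {p : ℝ × ℝ | p.1 ∈ Icc ((0 : ℤ) : ℝ) r ∧ p.2 ∈ Icc (g p.1) (f p.1)} := by
    apply Subset.antisymm
    · rw [image_subset_iff]
      refine convexHull_min (fun p hp => ?_) (hK.convex.affine_preimage Φ.toAffineMap)
      rw [mem_preimage, hΦv']
      simpa using hS p hp
    · rintro p ⟨hp1, hp2⟩
      have hp1' : p.1 ∈ Icc (0 : ℝ) r := by simpa using hp1
      have h1 : (p.1, g p.1) ∈ Φ '' convexHull ℝ S := ⟨_, hgS _ hp1', hΦv' _⟩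
      have h2 : (p.1, f p.1) ∈ Φ '' convexHull ℝ S := ⟨_, hfS _ hp1', hΦv' _⟩
      refine hconv.segment_subset h1 h2 ?_
      rw [← Prod.image_mk_segment_right]
      exact ⟨p.2, by rw [segment_eq_Icc (hp2.1.trans hp2.2)]; exact hp2, rfl⟩
  rw [← himg] at hK
  have hne : (interior (Φ '' convexHull ℝ S)).Nonempty := by
    refine ⟨(x₀, (g x₀ + f x₀) / 2), ?_⟩
    rw [hK.interior_eq]
    exact ⟨by simpa using hx₀, by simp only; linarith, by simp only; linarith⟩
  have hP : IsConvexLatticePolygon (convexHull ℝ S) := by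
    refine ⟨⟨hfin.toFinset, by simpa using hlat, by simp⟩, ?_⟩
    rw [← image_interior] at hne
    exact hne.of_image
  have hQ := hP.image hΦ
  have hb' : (boundaryPoints (convexHull ℝ S) : ℤ) = b := by
    rw [← boundaryPoints_image hΦ, hK.boundaryPoints_eq hQ.isClosed hne, ← hb]
    simp
  have hi' : (interiorPoints (convexHull ℝ S) : ℤ) = i := by
    rw [← interiorPoints_image hΦ, hK.interiorPoints_eq hne, ← hi]
  have hbR : (boundaryPoints (convexHull ℝ S) : ℝ) = b := by exact_mod_cast hb'
  have hiR : (interiorPoints (convexHull ℝ S) : ℝ) = i := by exact_mod_cast hi'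
  exact ⟨hP, by rw [hP.pick, hbR, hiR], hbR, hiR⟩

theorem mem_hull_of_combination {S : Set (ℝ × ℝ)} {u v p : ℝ × ℝ} (hu : u ∈ S) (hv : v ∈ S)
    {t : ℝ} (h0 : 0 ≤ t) (h1 : t ≤ 1) (h : p = ((1 - t) * u.1 + t * v.1, (1 - t) * u.2 + t * v.2)) :
    p ∈ convexHull ℝ S := by
  have := (convex_convexHull ℝ S) (subset_convexHull ℝ S hu) (subset_convexHull ℝ S hv)
    (show 0 ≤ 1 - t by linarith) h0 (by ring)
  rw [h]
  exact this

theorem Ioo_zero_two : Finset.Ioo (0 : ℤ) 2 = {1} := by decide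

theorem realizes_without_interior {b : ℤ} (hb : 3 ≤ b) :
    Realizes (convexHull ℝ {(0, 0), ((b : ℝ) - 2, 0), (0, 1)}) (0 + (b : ℝ) / 2 - 1) b 0 := by
  have hbR : (3 : ℝ) ≤ b := by exact_mod_cast hb
  have key := realizes_of_rows (S := {(0, 0), ((b : ℝ) - 2, 0), (0, 1)}) (r := 1) (b := b) (i := 0)
    (f := fun x => ((b : ℝ) - 2) + (-((b : ℝ) - 2)) * x) (g := fun _ => 0) (toFinite _)
    (by
      rintro p (rfl | rfl | rfl)
      · exact ⟨0, 0, by simp⟩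
      · exact ⟨b - 2, 0, by simp⟩
      · exact ⟨0, 1, by simp⟩)
    (by norm_num)
    (Roof.affine ⟨b - 2, by simp⟩ ⟨0, by simp⟩)
    (by simpa using Roof.affine (c := 0) (s := 0) (l := 0) (r := 1) ⟨0, by simp⟩ ⟨0, by simp⟩)
    (by
      rintro x ⟨h1, h2⟩
      push_cast at h2
      nlinarith)
    (x₀ := 1 / 2) (by constructor <;> norm_num) (by linarith)
    (by
      rintro p (rfl | rfl | rfl)
      · simp; linarith
      · simp; linarith
      · simp)
    (by
      rintro x ⟨h1, h2⟩
      push_cast at h2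
      refine mem_hull_of_combination (u := ((b : ℝ) - 2, 0)) (v := (0, 1)) (by simp) (by simp)
        h1 h2 ?_
      ext <;> simp only <;> ring)
    (by
      rintro x ⟨h1, h2⟩
      push_cast at h2
      refine mem_hull_of_combination (u := (0, 0)) (v := (0, 1)) (by simp) (by simp) h1 h2 ?_
      ext <;> simp only <;> ring)
    (by
      have : Finset.Ioo (0 : ℤ) 1 = ∅ := by decide
      rw [this]
      have e : ((b : ℝ) - 2) + (-((b : ℝ) - 2)) * 0 = ((b - 2 : ℤ) : ℝ) := by push_cast; ring
      have e' : ((b : ℝ) - 2) + (-((b : ℝ) - 2)) * ((1 : ℤ) : ℝ) = ((0 : ℤ) : ℝ) := by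
        push_cast; ring
      simp only [e, e', Int.floor_intCast]
      simp
      ring)
    (by
      have : Finset.Ioo (0 : ℤ) 1 = ∅ := by decide
      rw [this]
      simp)
  simpa using key

theorem realizes_three {i : ℤ} (hi : 1 ≤ i) :
    Realizes (convexHull ℝ {(0, 0), (1, 2), ((i : ℝ) + 1, 1)}) ((i : ℝ) + 3 / 2 - 1) 3 i := by
  have hiR : (1 : ℝ) ≤ i := by exact_mod_cast hi
  have ht : (0 : ℤ) + 1 ≤ 2 * (i + 1) := by omega
  have key := realizes_of_rows (S := {(0, 0), (1, 2), ((i : ℝ) + 1, 1)}) (r := 2) (b := 3) (i := i)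
    (f := fun x => min (((0 : ℤ) : ℝ) + ((i + 1 : ℤ) - (0 : ℤ)) * x)
      (2 * (i + 1 : ℤ) - (1 : ℤ) + ((1 : ℤ) - (i + 1 : ℤ)) * x))
    (g := fun x => 1 / 2 * x) (toFinite _)
    (by
      rintro p (rfl | rfl | rfl)
      · exact ⟨0, 0, by simp⟩
      · exact ⟨1, 2, by simp⟩
      · exact ⟨i + 1, 1, by simp⟩)
    (by norm_num)
    (Roof.tent ht)
    (by
      have := Roof.affine (c := 0) (s := -(1 / 2)) (l := 0) (r := 2) ⟨0, by simp⟩ ⟨-1, by norm_num⟩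
      simpa using this)
    (by
      rintro x ⟨h1, h2⟩
      push_cast at h2 ⊢
      refine le_min ?_ ?_ <;> nlinarith)
    (x₀ := 1) (by constructor <;> norm_num)
    (by
      push_cast
      refine lt_min ?_ ?_ <;> linarith)
    (by
      rintro p (rfl | rfl | rfl)
      · simp; linarith
      · simp only
        rw [tent_of_one_le ht (by norm_num)]
        push_cast
        refine ⟨⟨by norm_num, by norm_num⟩, by norm_num, by linarith⟩
      · norm_num
        constructor <;> linarith)
    (by
      rintro x ⟨h1, h2⟩
      push_cast at h2
      rcases le_total x 1 with hx | hx
      · refine mem_hull_of_combination (u := (0, 0)) (v := ((i : ℝ) + 1, 1)) (by simp) (by simp)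
          h1 hx ?_
        rw [tent_of_le_one ht hx]
        push_cast
        ext <;> simp only <;> ring
      · refine mem_hull_of_combination (u := ((i : ℝ) + 1, 1)) (v := (1, 2)) (t := x - 1)
          (by simp) (by simp) (by linarith) (by linarith) ?_
        rw [tent_of_one_le ht hx]
        push_cast
        ext <;> simp only <;> ring)
    (by
      rintro x ⟨h1, h2⟩
      push_cast at h2
      refine mem_hull_of_combination (u := (0, 0)) (v := (1, 2)) (t := x / 2) (by simp) (by simp)
        (by linarith) (by linarith) ?_
      ext <;> simp only <;> ring)
    (by
      rw [Ioo_zero_two, Finset.sum_singleton, tent_of_le_one ht (by norm_num),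
        tent_of_le_one ht (by norm_num), tent_of_one_le ht (by norm_num),
        chi_eq_one ⟨i + 1, by push_cast; ring⟩, chi_eq_zero]
      · have e : 2 * (((i + 1 : ℤ) : ℝ)) - ((1 : ℤ) : ℝ)
            + (((1 : ℤ) : ℝ) - ((i + 1 : ℤ) : ℝ)) * ((2 : ℤ) : ℝ) = ((1 : ℤ) : ℝ) := by
          push_cast; ring
        rw [e]
        norm_num
      -- Row 1 begins at abscissa 1/2, so the left edge has no lattice point there.
      · rintro ⟨y, hy⟩
        push_cast at hy
        have : (1 : ℝ) = 2 * y := by linarith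
        have : (1 : ℤ) = 2 * y := by exact_mod_cast this
        omega)
    (by
      rw [Ioo_zero_two, Finset.sum_singleton, tent_of_le_one ht (by norm_num)]
      have e : ((0 : ℤ) : ℝ) + (((i + 1 : ℤ) : ℝ) - ((0 : ℤ) : ℝ)) * ((1 : ℤ) : ℝ)
          = ((i + 1 : ℤ) : ℝ) := by push_cast; ring
      rw [e, Int.ceil_intCast]
      norm_num)
  simpa using key

theorem realizes_four_le {b i : ℤ} (hi : 1 ≤ i) (hb : 4 ≤ b) (hbi : b ≤ 2 * i + 6) :
    Realizes (convexHull ℝ {(0, 0), ((b : ℝ) - 4, 0), ((i : ℝ) + 1, 1), (0, 2)})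
      ((i : ℝ) + (b : ℝ) / 2 - 1) b i := by
  have hiR : (1 : ℝ) ≤ i := by exact_mod_cast hi
  have hbR : (4 : ℝ) ≤ b := by exact_mod_cast hb
  have hbiR : (b : ℝ) ≤ 2 * i + 6 := by exact_mod_cast hbi
  -- Concavity at the vertex `(i + 1, 1)` amounts exactly to b ≤ 2i + 6.
  have ht : (b - 4) + 0 ≤ 2 * (i + 1) := by omega
  exact realizes_of_rows (S := {(0, 0), ((b : ℝ) - 4, 0), ((i : ℝ) + 1, 1), (0, 2)}) (r := 2)
    (f := fun x => min (((b - 4 : ℤ) : ℝ) + ((i + 1 : ℤ) - (b - 4 : ℤ)) * x)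
      (2 * (i + 1 : ℤ) - (0 : ℤ) + ((0 : ℤ) - (i + 1 : ℤ)) * x))
    (g := fun _ => 0) (toFinite _)
    (by
      rintro p (rfl | rfl | rfl | rfl)
      · exact ⟨0, 0, by simp⟩
      · exact ⟨b - 4, 0, by simp⟩
      · exact ⟨i + 1, 1, by simp⟩
      · exact ⟨0, 2, by simp⟩)
    (by norm_num)
    (Roof.tent ht)
    (by simpa using Roof.affine (c := 0) (s := 0) (l := 0) (r := 2) ⟨0, by simp⟩ ⟨0, by simp⟩)
    (by
      rintro x ⟨h1, h2⟩
      push_cast at h2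
      rcases le_total x 1 with hx | hx
      · rw [tent_of_le_one ht hx]; push_cast; nlinarith
      · rw [tent_of_one_le ht hx]; push_cast; nlinarith)
    (x₀ := 1) (by constructor <;> norm_num)
    (by
      rw [tent_of_le_one ht le_rfl]
      push_cast
      linarith)
    (by
      rintro p (rfl | rfl | rfl | rfl)
      · simp only
        rw [tent_of_le_one ht (by norm_num)]
        push_cast
        refine ⟨⟨by norm_num, by norm_num⟩, by norm_num, by linarith⟩
      · simp only
        rw [tent_of_le_one ht (by norm_num)]
        push_cast
        refine ⟨⟨by norm_num, by norm_num⟩, by linarith, by linarith⟩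
      · simp only
        rw [tent_of_le_one ht (by norm_num)]
        push_cast
        refine ⟨⟨by norm_num, by norm_num⟩, by linarith, by linarith⟩
      · simp only
        rw [tent_of_one_le ht (by norm_num)]
        push_cast
        refine ⟨⟨by norm_num, by norm_num⟩, by norm_num, by linarith⟩)
    (by
      rintro x ⟨h1, h2⟩
      push_cast at h2
      rcases le_total x 1 with hx | hx
      · refine mem_hull_of_combination (u := ((b : ℝ) - 4, 0)) (v := ((i : ℝ) + 1, 1)) (by simp)
          (by simp) h1 hx ?_
        rw [tent_of_le_one ht hx]
        push_cast
        ext <;> simp only <;> ring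
      · refine mem_hull_of_combination (u := ((i : ℝ) + 1, 1)) (v := (0, 2)) (t := x - 1)
          (by simp) (by simp) (by linarith) (by linarith) ?_
        rw [tent_of_one_le ht hx]
        push_cast
        ext <;> simp only <;> ring)
    (by
      rintro x ⟨h1, h2⟩
      push_cast at h2
      refine mem_hull_of_combination (u := (0, 0)) (v := (0, 2)) (t := x / 2) (by simp) (by simp)
        (by linarith) (by linarith) ?_
      ext <;> simp only <;> ring)
    (by
      rw [Ioo_zero_two, Finset.sum_singleton, tent_of_le_one ht (by norm_num),
        tent_of_le_one ht (by norm_num), tent_of_one_le ht (by norm_num),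
        chi_eq_one ⟨i + 1, by push_cast; ring⟩, chi_eq_one ⟨0, by simp⟩]
      have e : 2 * (((i + 1 : ℤ) : ℝ)) - ((0 : ℤ) : ℝ)
          + (((0 : ℤ) : ℝ) - ((i + 1 : ℤ) : ℝ)) * ((2 : ℤ) : ℝ) = ((0 : ℤ) : ℝ) := by
        push_cast; ring
      have e' : ((b - 4 : ℤ) : ℝ) + (((i + 1 : ℤ) : ℝ) - ((b - 4 : ℤ) : ℝ)) * 0
          = ((b - 4 : ℤ) : ℝ) := by ring
      rw [e, e', Int.floor_intCast, Int.floor_intCast, Int.ceil_zero]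
      ring)
    (by
      rw [Ioo_zero_two, Finset.sum_singleton, tent_of_le_one ht (by norm_num)]
      have e : ((b - 4 : ℤ) : ℝ) + (((i + 1 : ℤ) : ℝ) - ((b - 4 : ℤ) : ℝ)) * ((1 : ℤ) : ℝ)
          = ((i + 1 : ℤ) : ℝ) := by push_cast; ring
      rw [e, Int.ceil_intCast, Int.floor_zero]
      ring)

theorem realizes_triangle_three : Realizes (triangle 3) (1 + 9 / 2 - 1) 9 1 := by
  have hP := triangle_polygon (k := 3) (by norm_num)
  have hb : (boundaryPoints (triangle ((3 : ℤ) : ℝ)) : ℝ) = 9 := by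
    exact_mod_cast boundaryPoints_triangle (k := 3) (by norm_num)
  have hi : (interiorPoints (triangle ((3 : ℤ) : ℝ)) : ℝ) = 1 := by
    exact_mod_cast interiorPoints_triangle_three
  have hA := hP.pick
  rw [hb, hi] at hA
  push_cast at hP hb hi hA
  exact ⟨hP, hA, hb, hi⟩

/-! ### Classification of the triples -/

theorem exists_realizes_iff (a b i : ℝ) : (∃ P : Set (ℝ × ℝ), Realizes P a b i) ↔
    ∃ m n : ℤ, b = (m : ℝ) ∧ i = (n : ℝ) ∧ 3 ≤ m ∧ 0 ≤ n ∧ a = i + b / 2 - 1 ∧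
      (n = 0 ∨ (n = 1 ∧ m ≤ 9) ∨ (2 ≤ n ∧ m ≤ 2 * n + 6)) := by
  constructor
  · rintro ⟨P, hP, rfl, rfl, rfl⟩
    refine ⟨boundaryPoints P, interiorPoints P, by simp, by simp, by exact_mod_cast hP.three_le,
      by positivity, hP.pick, ?_⟩
    by_cases h0 : interior P ∩ lattice = ∅
    · left
      rw [interiorPoints, h0, ncard_empty]
      rfl
    · have hi := nonempty_iff_ne_empty.2 h0
      have hpos : 0 < interiorPoints P := (ncard_pos hP.finite_interior).2 hi
      rcases hP.scott hi with h | h <;> omega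
  · rintro ⟨m, n, rfl, rfl, hm, -, rfl, h⟩
    by_cases h0 : n = 0
    · subst h0
      exact ⟨_, by simpa using realizes_without_interior hm⟩
    by_cases h3 : m = 3
    · subst h3
      exact ⟨_, by simpa using realizes_three (i := n) (by omega)⟩
    by_cases h6 : m ≤ 2 * n + 6
    · exact ⟨_, realizes_four_le (by omega) (by omega) h6⟩
    · obtain rfl : n = 1 := by omega
      obtain rfl : m = 9 := by omega
      exact ⟨_, by simpa using realizes_triangle_three⟩

end LatticePolygon

theorem mainTheorem2 :
    -- the classification of the triples (area, boundary points, interior points)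
    (∀ a b i : ℝ,
      (∃ P : Set (ℝ × ℝ), LatticePolygon.Realizes P a b i) ↔
        ∃ m n : ℤ, b = (m : ℝ) ∧ i = (n : ℝ) ∧ 3 ≤ m ∧ 0 ≤ n ∧ a = i + b / 2 - 1 ∧
          (n = 0 ∨ (n = 1 ∧ m ≤ 9) ∨ (2 ≤ n ∧ m ≤ 2 * n + 6))) ∧
    -- the inequality that involves the level
    (∀ P : Set (ℝ × ℝ), LatticePolygon.IsConvexLatticePolygon P →
      (2 * LatticePolygon.level P - 1) * (LatticePolygon.boundaryPoints P : ℝ) ≤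
        2 * (LatticePolygon.interiorPoints P : ℝ) + 9 * LatticePolygon.level P ^ 2 - 2) ∧
    -- explicit polygons: i = 0 and b ≥ 3
    (∀ b : ℤ, 3 ≤ b →
      LatticePolygon.Realizes (convexHull ℝ {(0, 0), ((b : ℝ) - 2, 0), (0, 1)})
        (0 + (b : ℝ) / 2 - 1) b 0) ∧
    -- i ≥ 1 and b = 3
    (∀ i : ℤ, 1 ≤ i →
      LatticePolygon.Realizes (convexHull ℝ {(0, 0), (1, 2), ((i : ℝ) + 1, 1)})
        ((i : ℝ) + 3 / 2 - 1) 3 i) ∧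
    -- i ≥ 1 and 4 ≤ b ≤ 2i + 6
    (∀ b i : ℤ, 1 ≤ i → 4 ≤ b → b ≤ 2 * i + 6 →
      LatticePolygon.Realizes
        (convexHull ℝ {(0, 0), ((b : ℝ) - 4, 0), ((i : ℝ) + 1, 1), (0, 2)})
        ((i : ℝ) + (b : ℝ) / 2 - 1) b i) ∧
    -- i = 1 and b = 9
    LatticePolygon.Realizes (LatticePolygon.triangle 3) (1 + 9 / 2 - 1) 9 1 :=
  ⟨LatticePolygon.exists_realizes_iff, fun _ hP => hP.level_inequality,
    fun _ hb => LatticePolygon.realizes_without_interior hb,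
    fun _ hi => LatticePolygon.realizes_three hi,
    fun _ _ hi hb hbi => LatticePolygon.realizes_four_le hi hb hbi,
    LatticePolygon.realizes_triangle_three⟩
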